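/- Let $A$ be a unital $C^*$-algebra. Its Cuntz semigroup $\mathrm{Cu}(A)$ is the set of classes $\langle a\rangle$ of positive elements $a$ of $A\otimes\mathcal K$ ($\mathcal K$ the compact operators on a separable infinite-dimensional Hilbert space), where $\langle a\rangle\le\langle b\rangle$ if $x_nbx_n^*\to a$ for some sequence $(x_n)$ in $A\otimes\mathcal K$, where $\langle a\rangle=\langle b\rangle$ if $\langle a\rangle\le\langle b\rangle\le\langle a\rangle$, and where addition is induced by orthogonal sums. Write $\langle 1_A\rangle$ for the class of $1_A\otimes e$ with $e$ a minimal projection in $\mathcal K$. For $u,v\in\mathrm{Cu}(A)$ write $u\ll v$ if, whenever $v=\sup_i v_i$ for an increasing sequence $(v_i)$ in $\mathrm{Cu}(A)$, then $u\le v_i$ for some $i$. For integers $m,n\ge 1$ an element $u\in\mathrm{Cu}(A)$ is called * $(m,n)$-divisible if for every $u'\ll u$ there is $x\in\mathrm{Cu}(A)$ with $mx\le u$ and $u'\le nx$; * $(m,n)$-decomposable if for every $u'\ll u$ there are $x_1,\dots,x_m\in\mathrm{Cu}(A)$ with $x_1+\cdots+x_m\le u$ and $u'\le nx_j$ for $j=1,\dots,m$;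 * weakly $(m,n)$-divisible if for every $u'\ll u$ there are $x_1,\dots,x_n\in\mathrm{Cu}(A)$ with $mx_j\le u$ for $j=1,\dots,n$ and $u'\le x_1+\cdots+x_n$. Let $\mathrm{Div}_m(A)$, $\partial\mathrm{iv}_m(A)$ and $\mathrm{div}_m(A)$ in $\{1,2,3,\dots,\infty\}$ be the least integer $n\ge 1$ such that $\langle 1_A\rangle$ is $(m,n)$-divisible, $(m,n)$-decomposable and weakly $(m,n)$-divisible, respectively ($\infty$ if there is no such $n$). For a sequence $(A_k)_{k\ge 1}$ of unital $C^*$-algebras let $\prod_{k=1}^\infty A_k$ be the $C^*$-algebra of all norm bounded sequences $(a_k)$ with $a_k\in A_k$. A (proper) filter $\omega$ on $\mathbb N$ is free if its members have empty intersection; for such $\omega$ let $\prod_\omega A_k$ be the quotient of $\prod_{k=1}^\infty A_k$ by the closed ideal of all $(a_k)$ with $\lim_\omega\|a_k\|=0$. For $d_k\in[0,\infty]$ put $\limsup_\omega d_k=\inf_{I\in\omega}\sup_{k\in I}d_k$. **Proposition.** Let $(A_k)$ be a sequence of unital $C^*$-algebras. Then for every integer $m\ge 2$ and every free filter $\omega$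 on $\mathbb N$: 1. $\mathrm{Div}_m\big(\prod_{k=1}^\infty A_k\big)=\sup_k\mathrm{Div}_m(A_k)$ and $\mathrm{Div}_m\big(\prod_\omega A_k\big)=\limsup_\omega\mathrm{Div}_m(A_k)$; 2. $\partial\mathrm{iv}_m\big(\prod_{k=1}^\infty A_k\big)=\sup_k\partial\mathrm{iv}_m(A_k)$ and $\partial\mathrm{iv}_m\big(\prod_\omega A_k\big)=\limsup_\omega\partial\mathrm{iv}_m(A_k)$; 3. $\mathrm{div}_m\big(\prod_{k=1}^\infty A_k\big)=\sup_k\mathrm{div}_m(A_k)$ and $\mathrm{div}_m\big(\prod_\omega A_k\big)=\limsup_\omega\mathrm{div}_m(A_k)$. -/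

import Mathlib

open Filter Topology
open scoped ENNReal

noncomputable section

namespace CuntzDiv

universe u

/-! ## Bounded products and reduced products of sequences of unital C⋆-algebras -/

section Products

variable (A : ℕ → Type u) [∀ k, CStarAlgebra (A k)]

/-- The C⋆-algebra `∏ₖ Aₖ` of all norm bounded sequences `(aₖ)` with `aₖ ∈ Aₖ`. -/
def BProd : Type u := lp A ∞

/-- The unit of a C⋆-algebra (possibly the zero algebra) has norm at most one. -/
theorem norm_one_le (B : Type u) [CStarAlgebra B] : ‖(1 : B)‖ ≤ 1 := by
  rcases subsingleton_or_nontrivial B with h | h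
  · rw [Subsingleton.elim (1 : B) 0, norm_zero]; exact zero_le_one
  · exact CStarRing.norm_one.le

instance instNonUnitalBProd : NonUnitalCStarAlgebra (BProd A) :=
  inferInstanceAs (NonUnitalCStarAlgebra (lp A ∞))

variable {A}

/-- The element of `∏ₖ Aₖ` given by a bounded sequence. -/
def BProd.mk (a : ∀ k, A k) (C : ℝ) (h : ∀ k, ‖a k‖ ≤ C) : BProd A :=
  ⟨a, memℓp_infty ⟨C, by rintro _ ⟨k, rfl⟩; exact h k⟩⟩

/-- The `k`-th coordinate of an element of `∏ₖ Aₖ`. -/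
def BProd.coord (a : BProd A) (k : ℕ) : A k := (show lp A ∞ from a).1 k

namespace BProd

theorem ext' {a b : BProd A} (h : ∀ k, a.coord k = b.coord k) : a = b :=
  lp.ext (funext h)

@[simp] theorem coord_mk (a : ∀ k, A k) (C : ℝ) (h : ∀ k, ‖a k‖ ≤ C) (k : ℕ) :
    (mk a C h).coord k = a k := rfl
@[simp] theorem coord_add (a b : BProd A) (k : ℕ) : (a + b).coord k = a.coord k + b.coord k := rfl
@[simp] theorem coord_sub (a b : BProd A) (k : ℕ) : (a - b).coord k = a.coord k - b.coord k := rfl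
@[simp] theorem coord_mul (a b : BProd A) (k : ℕ) : (a * b).coord k = a.coord k * b.coord k := rfl
@[simp] theorem coord_star (a : BProd A) (k : ℕ) : (star a).coord k = star (a.coord k) := rfl
@[simp] theorem coord_zero (k : ℕ) : (0 : BProd A).coord k = 0 := rfl
@[simp] theorem coord_smul (c : ℂ) (a : BProd A) (k : ℕ) :
    (c • a).coord k = c • a.coord k := rfl

theorem norm_coord_le (a : BProd A) (k : ℕ) : ‖a.coord k‖ ≤ ‖a‖ :=
  lp.norm_apply_le_norm ENNReal.top_ne_zero (show lp A ∞ from a) k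

theorem norm_le {a : BProd A} {C : ℝ} (hC : 0 ≤ C) (h : ∀ k, ‖a.coord k‖ ≤ C) : ‖a‖ ≤ C :=
  lp.norm_le_of_forall_le hC h

end BProd

instance instRingBProd : Ring (BProd A) :=
  { (inferInstance : NonUnitalRing (BProd A)) with
    one := BProd.mk (fun _ => 1) 1 (fun k => norm_one_le (A k))
    one_mul := fun a => BProd.ext' fun k => one_mul (a.coord k)
    mul_one := fun a => BProd.ext' fun k => mul_one (a.coord k) }

@[simp] theorem BProd.coord_one (k : ℕ) : (1 : BProd A).coord k = 1 := rfl

instance instNormedRingBProd : NormedRing (BProd A) :=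
  { instRingBProd, (inferInstance : NonUnitalNormedRing (BProd A)) with }

instance instAlgebraBProd : Algebra ℂ (BProd A) :=
  Algebra.ofModule (fun r x y => smul_mul_assoc r x y) (fun r x y => mul_smul_comm r x y)

instance instNormedAlgebraBProd : NormedAlgebra ℂ (BProd A) :=
  { instAlgebraBProd with norm_smul_le := fun r x => norm_smul_le r x }

instance instCStarAlgebraBProd : CStarAlgebra (BProd A) :=
  { instNormedRingBProd, instNormedAlgebraBProd, instNonUnitalBProd A with }

variable (A)

/-- The ideal `c_ω({Aₖ})` of all `(aₖ)` with `lim_ω ‖aₖ‖ = 0`. -/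
def cIdeal (ω : Filter ℕ) : Ideal (BProd A) where
  carrier := {a | Tendsto (fun k => ‖a.coord k‖) ω (𝓝 0)}
  add_mem' {a b} ha hb := by
    refine squeeze_zero (fun _ => norm_nonneg _) (fun k => norm_add_le (a.coord k) (b.coord k)) ?_
    simpa using Tendsto.add ha hb
  zero_mem' := by simpa using tendsto_const_nhds
  smul_mem' c a ha := by
    refine squeeze_zero (fun _ => norm_nonneg _) (fun k => ?_)
      (by simpa using Tendsto.const_mul ‖c‖ ha)
    exact (norm_mul_le (c.coord k) (a.coord k)).trans
      (mul_le_mul_of_nonneg_right (c.norm_coord_le k) (norm_nonneg _))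

variable {A}

theorem mem_cIdeal {ω : Filter ℕ} {a : BProd A} :
    a ∈ cIdeal A ω ↔ Tendsto (fun k => ‖a.coord k‖) ω (𝓝 0) := Iff.rfl

instance instTwoSided (ω : Filter ℕ) : (cIdeal A ω).IsTwoSided where
  mul_mem_of_left {a} b ha := by
    refine squeeze_zero (fun _ => norm_nonneg _) (fun k => ?_)
      (by simpa using Tendsto.mul_const ‖b‖ (mem_cIdeal.1 ha))
    exact (norm_mul_le (a.coord k) (b.coord k)).trans
      (mul_le_mul_of_nonneg_left (b.norm_coord_le k) (norm_nonneg _))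

instance instClosedIdeal (ω : Filter ℕ) : IsClosed (cIdeal A ω : Set (BProd A)) := by
  refine isClosed_of_closure_subset fun a ha => ?_
  change Tendsto (fun k => ‖a.coord k‖) ω (𝓝 0)
  rw [Metric.tendsto_nhds]
  intro ε hε
  obtain ⟨b, hb, hab⟩ := Metric.mem_closure_iff.1 ha (ε / 2) (half_pos hε)
  filter_upwards [(Metric.tendsto_nhds.1 (mem_cIdeal.1 hb)) (ε / 2) (half_pos hε)] with k hk
  rw [Real.dist_0_eq_abs, abs_norm] at hk ⊢
  have h1 : ‖a.coord k - b.coord k‖ ≤ ‖a - b‖ := (a - b).norm_coord_le k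
  rw [dist_eq_norm] at hab
  have h2 : ‖a.coord k‖ ≤ ‖a.coord k - b.coord k‖ + ‖b.coord k‖ := by
    simpa using norm_add_le (a.coord k - b.coord k) (b.coord k)
  linarith

theorem star_mem_cIdeal {ω : Filter ℕ} {a : BProd A} (ha : a ∈ cIdeal A ω) :
    star a ∈ cIdeal A ω := by
  rw [mem_cIdeal] at ha ⊢
  simpa using ha

variable (A)

/-- The C⋆-algebra `∏_ω Aₖ`, the quotient of `∏ₖ Aₖ` by the ideal `c_ω({Aₖ})`. -/
def RProd (ω : Filter ℕ) : Type u := BProd A ⧸ cIdeal A ω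

instance instRingRProd (ω : Filter ℕ) : Ring (RProd A ω) :=
  inferInstanceAs (Ring (BProd A ⧸ cIdeal A ω))

instance instAlgebraRProd (ω : Filter ℕ) : Algebra ℂ (RProd A ω) :=
  inferInstanceAs (Algebra ℂ (BProd A ⧸ cIdeal A ω))

/-- `RProd A ω` carries the quotient norm. -/
instance instNormedGroupRProd (ω : Filter ℕ) : NormedAddCommGroup (RProd A ω) :=
  inferInstanceAs (NormedAddCommGroup (BProd A ⧸ cIdeal A ω))

instance instCompleteRProd (ω : Filter ℕ) : CompleteSpace (RProd A ω) :=
  inferInstanceAs (CompleteSpace (BProd A ⧸ cIdeal A ω))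

variable {A}

/-- The quotient map `∏ₖ Aₖ → ∏_ω Aₖ`. -/
def RProd.mk (ω : Filter ℕ) : BProd A →ₐ[ℂ] RProd A ω := Ideal.Quotient.mkₐ ℂ (cIdeal A ω)

theorem RProd.mk_surjective (ω : Filter ℕ) : Function.Surjective (RProd.mk (A := A) ω) :=
  Ideal.Quotient.mk_surjective

theorem RProd.mk_eq_mk {ω : Filter ℕ} {a b : BProd A} :
    RProd.mk ω a = RProd.mk ω b ↔ a - b ∈ cIdeal A ω :=
  Ideal.Quotient.eq

theorem RProd.norm_mk_le (ω : Filter ℕ) (a : BProd A) : ‖RProd.mk ω a‖ ≤ ‖a‖ :=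
  Submodule.Quotient.norm_mk_le (cIdeal A ω) a

theorem RProd.exists_norm_lt {ω : Filter ℕ} (x : RProd A ω) {ε : ℝ} (hε : 0 < ε) :
    ∃ a, RProd.mk ω a = x ∧ ‖a‖ < ‖x‖ + ε :=
  Submodule.Quotient.norm_mk_lt (S := cIdeal A ω) x hε

theorem RProd.eventually_lt {ω : Filter ℕ} {a : BProd A} {r : ℝ} (h : ‖RProd.mk ω a‖ < r) :
    ∀ᶠ k in ω, ‖a.coord k‖ < r := by
  obtain ⟨b, hb, hbr⟩ := RProd.exists_norm_lt (RProd.mk ω a) (ε := r - ‖RProd.mk ω a‖) (by linarith)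
  have hbr' : ‖b‖ < r := by linarith
  have hab := mem_cIdeal.1 (RProd.mk_eq_mk.1 hb.symm)
  filter_upwards [(Metric.tendsto_nhds.1 hab) (r - ‖b‖) (by linarith)] with k hk
  rw [Real.dist_0_eq_abs, abs_norm, BProd.coord_sub] at hk
  have h2 : ‖a.coord k‖ ≤ ‖a.coord k - b.coord k‖ + ‖b.coord k‖ := by
    simpa using norm_add_le (a.coord k - b.coord k) (b.coord k)
  linarith [b.norm_coord_le k]

theorem RProd.norm_le {ω : Filter ℕ} {a : BProd A} {r : ℝ} (hr : 0 ≤ r)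
    (h : ∀ᶠ k in ω, ‖a.coord k‖ ≤ r) : ‖RProd.mk ω a‖ ≤ r := by
  classical
  let b : BProd A := BProd.mk (fun k => if ‖a.coord k‖ ≤ r then a.coord k else 0) r (fun k => by
    split_ifs with h
    · exact h
    · simpa using hr)
  have hb : RProd.mk ω a = RProd.mk ω b := by
    rw [RProd.mk_eq_mk, mem_cIdeal]
    refine (tendsto_congr' ?_).2 tendsto_const_nhds
    filter_upwards [h] with k hk
    simp [b, hk]
  rw [hb]
  refine (RProd.norm_mk_le ω b).trans (BProd.norm_le hr fun k => ?_)
  simp only [b, BProd.coord_mk]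
  split_ifs with h
  · exact h
  · simpa using hr

variable (A)

instance instNormedRingRProd (ω : Filter ℕ) : NormedRing (RProd A ω) :=
  { instRingRProd A ω, instNormedGroupRProd A ω with
    norm_mul_le := fun x y => by
      obtain ⟨a, rfl⟩ := RProd.mk_surjective ω x
      obtain ⟨b, rfl⟩ := RProd.mk_surjective ω y
      refine le_of_forall_pos_le_add fun ε hε => ?_
      have hc : Tendsto (fun δ : ℝ => (‖RProd.mk ω a‖ + δ) * (‖RProd.mk ω b‖ + δ)) (𝓝[>] 0)
          (𝓝 (‖RProd.mk ω a‖ * ‖RProd.mk ω b‖)) := by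
        have : Continuous fun δ : ℝ => (‖RProd.mk ω a‖ + δ) * (‖RProd.mk ω b‖ + δ) := by fun_prop
        simpa using (this.tendsto 0).mono_left nhdsWithin_le_nhds
      obtain ⟨δ, h1, h2⟩ := ((hc.eventually (gt_mem_nhds (lt_add_of_pos_right _ hε))).and
        self_mem_nhdsWithin).exists
      have hδ : 0 < δ := h2
      refine le_trans ?_ h1.le
      refine RProd.norm_le (a := a * b) (by positivity) ?_
      filter_upwards [RProd.eventually_lt (lt_add_of_pos_right ‖RProd.mk ω a‖ hδ),
        RProd.eventually_lt (lt_add_of_pos_right ‖RProd.mk ω b‖ hδ)] with k ha hb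
      exact (norm_mul_le _ _).trans (mul_le_mul ha.le hb.le (norm_nonneg _) (by positivity)) }

instance instStarRProd (ω : Filter ℕ) : Star (RProd A ω) where
  star := Quotient.lift (fun a : BProd A => RProd.mk ω (star a)) (fun a b hab => by
    have h : RProd.mk ω a = RProd.mk ω b := Quotient.sound hab
    rw [RProd.mk_eq_mk] at h ⊢
    rw [← star_sub]
    exact star_mem_cIdeal h)

theorem RProd.star_mk (ω : Filter ℕ) (a : BProd A) :
    star (RProd.mk ω a) = RProd.mk ω (star a) := rfl

instance instStarRingRProd (ω : Filter ℕ) : StarRing (RProd A ω) where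
  star_involutive x := by
    obtain ⟨a, rfl⟩ := RProd.mk_surjective ω x
    simp [RProd.star_mk]
  star_mul x y := by
    obtain ⟨a, rfl⟩ := RProd.mk_surjective ω x
    obtain ⟨b, rfl⟩ := RProd.mk_surjective ω y
    simp only [RProd.star_mk, ← map_mul, star_mul]
  star_add x y := by
    obtain ⟨a, rfl⟩ := RProd.mk_surjective ω x
    obtain ⟨b, rfl⟩ := RProd.mk_surjective ω y
    simp only [RProd.star_mk, ← map_add, star_add]

instance instNormedAlgebraRProd (ω : Filter ℕ) : NormedAlgebra ℂ (RProd A ω) :=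
  { instAlgebraRProd A ω with
    norm_smul_le := fun c x =>
      norm_smul_le (α := ℂ) (β := BProd A ⧸ cIdeal A ω) c x }

instance instCStarAlgebraRProd (ω : Filter ℕ) : CStarAlgebra (RProd A ω) where
  norm_mul_self_le x := by
    obtain ⟨a, rfl⟩ := RProd.mk_surjective ω x
    refine le_of_forall_gt_imp_ge_of_dense fun s hs => ?_
    have hs0 : 0 ≤ s := (norm_nonneg _).trans hs.le
    rw [RProd.star_mk, ← map_mul] at hs
    have h : ‖RProd.mk ω a‖ ≤ √s := by
      refine RProd.norm_le (Real.sqrt_nonneg s) ?_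
      filter_upwards [RProd.eventually_lt hs] with k hk
      rw [BProd.coord_mul, BProd.coord_star, CStarRing.norm_star_mul_self] at hk
      exact Real.le_sqrt_of_sq_le (by nlinarith)
    calc ‖RProd.mk ω a‖ * ‖RProd.mk ω a‖ ≤ √s * √s := by gcongr
      _ = s := Real.mul_self_sqrt hs0
  star_smul c x := by
    obtain ⟨a, rfl⟩ := RProd.mk_surjective ω x
    simp only [RProd.star_mk, ← map_smul, star_smul]

end Products

/-! ## The stabilization `A ⊗ 𝒦` -/

section Stabilization

attribute [local instance] CStarAlgebra.spectralOrder CStarAlgebra.spectralOrderedRing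

/-- The matrix algebra `Mₙ(A)` with its C⋆-norm. -/
def MatN (A : Type u) (n : ℕ) : Type u := CStarMatrix (Fin n) (Fin n) A

variable (A : Type u) [CStarAlgebra A]

instance instCStarAlgebraMatN (n : ℕ) : CStarAlgebra (MatN A n) :=
  inferInstanceAs (CStarAlgebra (CStarMatrix (Fin n) (Fin n) A))

variable {A}

/-- The matrix in `Mₙ(A)` with entry `a` at position `(i, j)` and zeros elsewhere (the zero matrix
if `(i, j)` does not fit). -/
def MatN.single (n i j : ℕ) (a : A) : MatN A n :=
  CStarMatrix.ofMatrix fun p q => if p.1 = i ∧ q.1 = j then a else 0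

/-- The entries of a matrix. -/
def MatN.entry {A : Type u} {n : ℕ} (x : MatN A n) (p q : Fin n) : A :=
  CStarMatrix.ofMatrix.symm x p q

theorem MatN.ext' {A : Type u} {n : ℕ} {x y : MatN A n}
    (h : ∀ p q, x.entry p q = y.entry p q) : x = y :=
  CStarMatrix.ext h

theorem MatN.single_add (n i j : ℕ) (a b : A) :
    single n i j (a + b) = single n i j a + single n i j b := by
  refine MatN.ext' fun p q => ?_
  change (if p.1 = i ∧ q.1 = j then a + b else 0) =
    (if p.1 = i ∧ q.1 = j then a else 0) + (if p.1 = i ∧ q.1 = j then b else 0)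
  split_ifs <;> simp

theorem MatN.single_smul (n i j : ℕ) (c : ℂ) (a : A) :
    single n i j (c • a) = c • single n i j a := by
  refine MatN.ext' fun p q => ?_
  change (if p.1 = i ∧ q.1 = j then c • a else 0) = c • (if p.1 = i ∧ q.1 = j then a else 0)
  split_ifs <;> simp

theorem MatN.single_star (n i j : ℕ) (a : A) :
    star (single n i j a) = single n j i (star a) := by
  refine MatN.ext' fun p q => ?_
  change star (if q.1 = i ∧ p.1 = j then a else 0) = (if p.1 = j ∧ q.1 = i then star a else 0)
  by_cases h1 : q.1 = i <;> by_cases h2 : p.1 = j <;> simp [h1, h2]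

theorem MatN.single_mul (n i j k l : ℕ) (a b : A) :
    single n i j a * single n k l b = if j = k ∧ j < n then single n i l (a * b) else 0 := by
  have hsum : ∀ p q : Fin n, (single n i j a * single n k l b).entry p q =
      ∑ r : Fin n, (if p.1 = i ∧ r.1 = j then a else 0) * (if r.1 = k ∧ q.1 = l then b else 0) :=
    fun _ _ => rfl
  split_ifs with h
  · obtain ⟨rfl, hj⟩ := h
    refine MatN.ext' fun p q => ?_
    rw [hsum, Finset.sum_eq_single ⟨j, hj⟩]
    · change _ = if p.1 = i ∧ q.1 = l then a * b else 0
      by_cases h1 : p.1 = i <;> by_cases h2 : q.1 = l <;> simp [h1, h2]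
    · intro r _ hr
      have : r.1 ≠ j := fun h => hr (Fin.ext h)
      simp [this]
    · simp
  · refine MatN.ext' fun p q => ?_
    rw [hsum]
    change _ = (0 : A)
    refine Finset.sum_eq_zero fun r _ => ?_
    by_cases h1 : r.1 = j
    · have : r.1 ≠ k := fun h2 => h ⟨h1.symm.trans h2, h1 ▸ r.2⟩
      simp [this]
    · simp [h1]

theorem MatN.norm_single_le (n i j : ℕ) (a : A) : ‖single n i j a‖ ≤ ‖a‖ := by
  classical
  have hdiag : ∀ b : A, ‖single n j j b‖ ≤ ‖b‖ := by
    intro b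
    by_cases hj : j < n
    · let φ : A →⋆ₙₐ[ℂ] MatN A n :=
        { toFun := single n j j
          map_smul' := fun c x => single_smul n j j c x
          map_zero' := by
            have := single_smul n j j (0 : ℂ) (0 : A)
            simpa using this
          map_add' := fun x y => single_add n j j x y
          map_mul' := fun x y => by rw [single_mul, if_pos ⟨rfl, hj⟩]
          map_star' := fun x => (single_star n j j x).symm }
      exact NonUnitalStarAlgHom.norm_apply_le φ b
    · have : single n j j b = 0 := by
        refine MatN.ext' fun p q => ?_
        change (if p.1 = j ∧ q.1 = j then b else 0) = 0
        have : p.1 ≠ j := fun h => hj (h ▸ p.2)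
        simp [this]
      rw [this, norm_zero]
      exact norm_nonneg _
  have h1 : ‖single n i j a‖ * ‖single n i j a‖ ≤ ‖a‖ * ‖a‖ := by
    rw [← CStarRing.norm_star_mul_self, single_star, single_mul, ← CStarRing.norm_star_mul_self]
    split_ifs
    · exact hdiag _
    · rw [norm_zero]; exact norm_nonneg _
  exact abs_le_of_sq_le_sq' (by nlinarith) (norm_nonneg _) |>.2

variable (A)

/-- The C⋆-algebra `∏ₙ Mₙ(A) / ⊕ₙ Mₙ(A)`, in which the inductive limit of the matrix algebras
`Mₙ(A)` is realized. -/
abbrev MatSeq : Type u := RProd (MatN A) atTop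

variable {A}

/-- The element `a ⊗ eᵢⱼ` of the inductive limit of the matrix algebras `Mₙ(A)`, represented by the
sequence whose `n`-th term is the `n × n` matrix with entry `a` at position `(i, j)`. -/
def tensorUnit (i j : ℕ) (a : A) : MatSeq A :=
  RProd.mk atTop (BProd.mk (fun n => MatN.single n i j a) ‖a‖ (fun n => MatN.norm_single_le n i j a))

variable (A)

/-- The stabilization `A ⊗ 𝒦`: the C⋆-algebraic inductive limit of the matrix algebras `Mₙ(A)` along
the upper left corner embeddings `Mₙ(A) → Mₙ₊₁(A)`.  It is realized as the closed ⋆-subalgebra of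
`∏ₙ Mₙ(A) / ⊕ₙ Mₙ(A)` generated by the elements `a ⊗ eᵢⱼ`. -/
def stabSubalgebra : NonUnitalStarSubalgebra ℂ (MatSeq A) :=
  (NonUnitalStarAlgebra.adjoin ℂ
    {x : MatSeq A | ∃ (i j : ℕ) (a : A), x = tensorUnit i j a}).topologicalClosure

instance instClosedStab : IsClosed (stabSubalgebra A : Set (MatSeq A)) :=
  NonUnitalStarSubalgebra.isClosed_topologicalClosure _

/-- The stabilization `A ⊗ 𝒦` as a C⋆-algebra. -/
def Stab : Type u := stabSubalgebra A

instance instCStarAlgebraStab : NonUnitalCStarAlgebra (Stab A) :=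
  inferInstanceAs (NonUnitalCStarAlgebra (stabSubalgebra A))

variable {A}

/-- The element `a ⊗ eᵢⱼ` of `A ⊗ 𝒦`. -/
def Stab.single (i j : ℕ) (a : A) : Stab A :=
  ⟨tensorUnit i j a, NonUnitalStarSubalgebra.le_topologicalClosure _
    (NonUnitalStarAlgebra.subset_adjoin ℂ _ ⟨i, j, a, rfl⟩)⟩

namespace Stab

theorem ext_mk {x y : Stab A} (h : x.1 = y.1) : x = y := Subtype.ext h

theorem single_add (i j : ℕ) (a b : A) : single i j (a + b) = single i j a + single i j b := by
  refine ext_mk ?_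
  change RProd.mk atTop _ = RProd.mk atTop _ + RProd.mk atTop _
  rw [← map_add]
  exact congrArg _ (BProd.ext' fun n => MatN.single_add n i j a b)

theorem single_smul (i j : ℕ) (c : ℂ) (a : A) : single i j (c • a) = c • single i j a := by
  refine ext_mk ?_
  change RProd.mk atTop _ = c • RProd.mk atTop _
  rw [← map_smul]
  exact congrArg _ (BProd.ext' fun n => MatN.single_smul n i j c a)

theorem single_zero (i j : ℕ) : single i j (0 : A) = 0 := by
  simpa using single_smul i j (0 : ℂ) (0 : A)

theorem star_single (i j : ℕ) (a : A) : star (single i j a) = single j i (star a) := by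
  refine ext_mk ?_
  change star (RProd.mk atTop _) = RProd.mk atTop _
  rw [RProd.star_mk]
  exact congrArg _ (BProd.ext' fun n => MatN.single_star n i j a)

theorem single_mul_single (i j k l : ℕ) (a b : A) :
    single i j a * single k l b = if j = k then single i l (a * b) else 0 := by
  refine ext_mk ?_
  change RProd.mk atTop _ * RProd.mk atTop _ = _
  rw [← map_mul]
  split_ifs with h
  · change _ = RProd.mk atTop _
    rw [RProd.mk_eq_mk, mem_cIdeal]
    refine (tendsto_congr' ?_).2 tendsto_const_nhds
    filter_upwards [eventually_gt_atTop j] with n hn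
    simp [MatN.single_mul, h, h ▸ hn]
  · change _ = (0 : MatSeq A)
    rw [← map_zero (RProd.mk (A := MatN A) atTop)]
    refine congrArg _ (BProd.ext' fun n => ?_)
    simp [MatN.single_mul, h]

theorem norm_single_le (i j : ℕ) (a : A) : ‖single i j a‖ ≤ ‖a‖ :=
  (RProd.norm_mk_le atTop _).trans
    (BProd.norm_le (norm_nonneg _) fun n => MatN.norm_single_le n i j a)

end Stab

namespace Stab

/-- The partial isometry `∑_{i < n} 1 ⊗ e_{f(i),i}` for an injective map `f`; for `f = id` it is the
projection `1 ⊗ (e₀₀ + ⋯ + eₙ₋₁,ₙ₋₁)`. -/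
def shift (A : Type u) [CStarAlgebra A] (f : ℕ → ℕ) (n : ℕ) : Stab A :=
  ∑ i ∈ Finset.range n, single (f i) i 1

theorem star_shift (f : ℕ → ℕ) (n : ℕ) :
    star (shift A f n) = ∑ i ∈ Finset.range n, single i (f i) 1 := by
  simp [shift, star_sum, star_single]

theorem star_shift_mul_shift {f : ℕ → ℕ} (hf : f.Injective) {m n : ℕ} (h : n ≤ m) :
    star (shift A f m) * shift A f n = shift A id n := by
  rw [star_shift, shift, Finset.sum_mul_sum, Finset.sum_comm, shift]
  refine Finset.sum_congr rfl fun j hj => ?_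
  rw [Finset.sum_eq_single j]
  · simp [single_mul_single]
  · intro i _ hij
    rw [single_mul_single, if_neg fun h => hij (hf h)]
  · intro h'
    exact absurd (Finset.mem_range.2 ((Finset.mem_range.1 hj).trans_le h)) h'

theorem star_shift_mul_shift_of_disjoint {f g : ℕ → ℕ} (h : ∀ i j, f i ≠ g j) (m n : ℕ) :
    star (shift A f m) * shift A g n = 0 := by
  rw [star_shift, shift, Finset.sum_mul_sum]
  refine Finset.sum_eq_zero fun i _ => Finset.sum_eq_zero fun j _ => ?_
  rw [single_mul_single, if_neg (h i j)]

theorem shift_mul_proj (f : ℕ → ℕ) {m n : ℕ} (h : n ≤ m) :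
    shift A f m * shift A id n = shift A f n := by
  rw [shift, shift, Finset.sum_mul_sum, Finset.sum_comm, shift]
  refine Finset.sum_congr rfl fun j hj => ?_
  rw [Finset.sum_eq_single j]
  · simp [single_mul_single]
  · intro i _ hij
    simp [single_mul_single, hij]
  · intro h'
    exact absurd (Finset.mem_range.2 ((Finset.mem_range.1 hj).trans_le h)) h'

theorem star_proj (n : ℕ) : star (shift A id n) = shift A id n := by
  rw [star_shift]; rfl

theorem proj_mul_star_shift (f : ℕ → ℕ) {m n : ℕ} (h : n ≤ m) :
    shift A id n * star (shift A f m) = star (shift A f n) := by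
  rw [← shift_mul_proj f h, star_mul, star_proj]

theorem norm_proj_le (n : ℕ) : ‖shift A id n‖ ≤ 1 := by
  have h := CStarRing.norm_star_mul_self (x := shift A id n)
  rw [star_shift_mul_shift Function.injective_id le_rfl] at h
  by_contra! hc
  nlinarith

theorem norm_shift_le {f : ℕ → ℕ} (hf : f.Injective) (n : ℕ) : ‖shift A f n‖ ≤ 1 := by
  have h := CStarRing.norm_star_mul_self (x := shift A f n)
  rw [star_shift_mul_shift hf le_rfl] at h
  have := norm_proj_le (A := A) n
  by_contra! hc
  nlinarith

theorem norm_conj_le {u x : Stab A} (hu : ‖u‖ ≤ 1) : ‖u * x * star u‖ ≤ ‖x‖ := by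
  have h1 : ‖u * x * star u‖ ≤ ‖u‖ * ‖x‖ * ‖u‖ := by
    simpa using (norm_mul_le (u * x) (star u)).trans
      (mul_le_mul_of_nonneg_right (norm_mul_le u x) (norm_nonneg _))
  have h2 : ‖u‖ * ‖x‖ ≤ ‖x‖ := by nlinarith [norm_nonneg x]
  nlinarith [norm_nonneg u, norm_nonneg x, mul_nonneg (norm_nonneg u) (norm_nonneg x)]

/-- Elements supported in a finite matrix block are dense in `A ⊗ 𝒦`. -/
theorem exists_approx (x : Stab A) {ε : ℝ} (hε : 0 < ε) :
    ∃ y : Stab A, ‖x - y‖ < ε ∧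
      ∀ᶠ n in atTop, shift A id n * y = y ∧ y * shift A id n = y := by
  have key : ∀ y ∈ NonUnitalStarAlgebra.adjoin ℂ
      {x : MatSeq A | ∃ (i j : ℕ) (a : A), x = tensorUnit i j a},
      ∀ᶠ n in atTop, (shift A id n).1 * y = y ∧ y * (shift A id n).1 = y := by
    intro y hy
    induction hy using NonUnitalStarAlgebra.adjoin_induction with
    | mem y hy =>
      obtain ⟨i, j, a, rfl⟩ := hy
      filter_upwards [eventually_gt_atTop i, eventually_gt_atTop j] with n hi hj
      have h1 : shift A id n * single i j a = single i j a := by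
        rw [shift, Finset.sum_mul, Finset.sum_eq_single i]
        · simp [single_mul_single]
        · intro k _ hk
          rw [single_mul_single, if_neg hk]
        · intro h; exact absurd (Finset.mem_range.2 hi) h
      have h2 : single i j a * shift A id n = single i j a := by
        rw [shift, Finset.mul_sum, Finset.sum_eq_single j]
        · simp [single_mul_single]
        · intro k _ hk
          rw [single_mul_single, if_neg fun h => hk h.symm]
        · intro h; exact absurd (Finset.mem_range.2 hj) h
      exact ⟨congrArg Subtype.val h1, congrArg Subtype.val h2⟩
    | add y z _ _ hy hz =>
      filter_upwards [hy, hz] with n h1 h2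
      rw [mul_add, add_mul, h1.1, h1.2, h2.1, h2.2]
      exact ⟨rfl, rfl⟩
    | zero => simp
    | mul y z _ _ hy hz =>
      filter_upwards [hy, hz] with n h1 h2
      rw [← mul_assoc, h1.1, mul_assoc, h2.2]
      exact ⟨rfl, rfl⟩
    | smul r y _ hy =>
      filter_upwards [hy] with n h1
      rw [mul_smul_comm, smul_mul_assoc, h1.1, h1.2]
      exact ⟨rfl, rfl⟩
    | star y _ hy =>
      filter_upwards [hy] with n h1
      have h3 : star (shift A id n).1 = (shift A id n).1 := congrArg Subtype.val (star_proj n)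
      constructor
      · conv_lhs => rw [← h3, ← star_mul, h1.2]
      · conv_lhs => rw [← h3, ← star_mul, h1.1]
  obtain ⟨y, hy, hxy⟩ := Metric.mem_closure_iff.1 x.2 ε hε
  refine ⟨⟨y, NonUnitalStarSubalgebra.le_topologicalClosure _ hy⟩, ?_, ?_⟩
  · rw [dist_eq_norm] at hxy
    exact hxy
  · filter_upwards [key y hy] with n hn
    exact ⟨Subtype.ext hn.1, Subtype.ext hn.2⟩

theorem tendsto_proj_mul (x : Stab A) :
    Tendsto (fun n => shift A id n * x) atTop (𝓝 x) := by
  rw [Metric.tendsto_nhds]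
  intro ε hε
  obtain ⟨y, hxy, hy⟩ := exists_approx x (half_pos hε)
  filter_upwards [hy] with n hn
  have h1 : shift A id n * x - x = shift A id n * (x - y) - (x - y) := by
    rw [mul_sub, hn.1]; abel
  rw [dist_eq_norm, h1]
  have h2 := norm_sub_le (shift A id n * (x - y)) (x - y)
  have h3 := norm_mul_le (shift A id n) (x - y)
  have h4 := norm_proj_le (A := A) n
  nlinarith [norm_nonneg (x - y)]

theorem tendsto_mul_proj (x : Stab A) :
    Tendsto (fun n => x * shift A id n) atTop (𝓝 x) := by
  have := (tendsto_proj_mul (star x)).star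
  simpa [star_proj] using this

theorem cauchySeq_conj {f : ℕ → ℕ} (hf : f.Injective) (x : Stab A) :
    CauchySeq fun n => shift A f n * x * star (shift A f n) := by
  rw [Metric.cauchySeq_iff']
  intro ε hε
  obtain ⟨y, hxy, hy⟩ := exists_approx x (half_pos hε)
  obtain ⟨N, hN⟩ := hy.exists
  refine ⟨N, fun n hn => ?_⟩
  have hconst : shift A f n * y * star (shift A f n) = shift A f N * y * star (shift A f N) := by
    have hy' : y = shift A id N * y * shift A id N := by rw [hN.1, hN.2]
    conv_lhs => rw [hy']
    rw [← shift_mul_proj f hn, star_mul, star_proj]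
    simp only [mul_assoc]
  have h1 : shift A f n * x * star (shift A f n) - shift A f N * x * star (shift A f N)
      = shift A f n * (x - y) * star (shift A f n)
        - shift A f N * (x - y) * star (shift A f N) := by
    simp only [mul_sub, sub_mul]
    rw [hconst]
    abel
  rw [dist_eq_norm, h1]
  have h2 := norm_sub_le (shift A f n * (x - y) * star (shift A f n))
    (shift A f N * (x - y) * star (shift A f N))
  have h3 := norm_conj_le (x := x - y) (norm_shift_le (A := A) hf n)
  have h4 := norm_conj_le (x := x - y) (norm_shift_le (A := A) hf N)
  linarith

/-- For an injective map `f : ℕ → ℕ`, the endomorphism of `A ⊗ 𝒦` that moves the matrix entry in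
position `(i, j)` to position `(f i, f j)`, i.e. `x ↦ V x V⋆` with the isometry
`V = ∑ᵢ 1 ⊗ e_{f(i),i}` of the multiplier algebra. -/
def relabel (f : ℕ → ℕ) (x : Stab A) : Stab A :=
  limUnder atTop fun n => shift A f n * x * star (shift A f n)

section relabel

variable {f g : ℕ → ℕ}

theorem tendsto_relabel (hf : f.Injective) (x : Stab A) :
    Tendsto (fun n => shift A f n * x * star (shift A f n)) atTop (𝓝 (relabel f x)) :=
  (cauchySeq_conj hf x).tendsto_limUnder

theorem relabel_single (hf : f.Injective) (i j : ℕ) (a : A) :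
    relabel f (single i j a) = single (f i) (f j) a := by
  refine tendsto_nhds_unique (tendsto_relabel hf _) ((tendsto_congr' ?_).2 tendsto_const_nhds)
  filter_upwards [eventually_gt_atTop i, eventually_gt_atTop j] with n hi hj
  rw [star_shift, shift, Finset.sum_mul, Finset.sum_mul, Finset.sum_eq_single i]
  · rw [Finset.mul_sum, Finset.sum_eq_single j]
    · simp [single_mul_single]
    · intro k _ hk
      simp [single_mul_single, hk.symm]
    · intro h; exact absurd (Finset.mem_range.2 hj) h
  · intro k _ hk
    rw [single_mul_single, if_neg hk, zero_mul]
  · intro h; exact absurd (Finset.mem_range.2 hi) h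

theorem relabel_sub (hf : f.Injective) (x y : Stab A) :
    relabel f (x - y) = relabel f x - relabel f y := by
  refine tendsto_nhds_unique (tendsto_relabel hf _) ?_
  simpa [mul_sub, sub_mul] using (tendsto_relabel hf x).sub (tendsto_relabel hf y)

theorem relabel_add (hf : f.Injective) (x y : Stab A) :
    relabel f (x + y) = relabel f x + relabel f y := by
  refine tendsto_nhds_unique (tendsto_relabel hf _) ?_
  simpa [mul_add, add_mul] using (tendsto_relabel hf x).add (tendsto_relabel hf y)

theorem relabel_star (hf : f.Injective) (x : Stab A) :
    relabel f (star x) = star (relabel f x) := by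
  refine tendsto_nhds_unique (tendsto_relabel hf _) ?_
  simpa [mul_assoc] using (tendsto_relabel hf x).star

theorem relabel_zero (hf : f.Injective) : relabel f (0 : Stab A) = 0 := by
  simpa using relabel_sub hf (0 : Stab A) 0

theorem norm_relabel_le (hf : f.Injective) (x : Stab A) : ‖relabel f x‖ ≤ ‖x‖ :=
  le_of_tendsto' (tendsto_relabel hf x).norm fun n => norm_conj_le (norm_shift_le hf n)

theorem relabel_id (x : Stab A) : relabel id x = x := by
  refine tendsto_nhds_unique (tendsto_relabel Function.injective_id x) ?_
  rw [Metric.tendsto_nhds]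
  intro ε hε
  obtain ⟨y, hxy, hy⟩ := exists_approx x (half_pos hε)
  filter_upwards [hy] with n hn
  have h1 : shift A id n * x * star (shift A id n) - x =
      shift A id n * (x - y) * star (shift A id n) - (x - y) := by
    have : shift A id n * y * star (shift A id n) = y := by rw [star_proj, hn.1, hn.2]
    rw [mul_sub, sub_mul, this]; abel
  rw [dist_eq_norm, h1]
  have h2 := norm_sub_le (shift A id n * (x - y) * star (shift A id n)) (x - y)
  have h3 := norm_conj_le (x := x - y) (norm_proj_le (A := A) n)
  linarith

theorem relabel_mul (hf : f.Injective) (x y : Stab A) :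
    relabel f (x * y) = relabel f x * relabel f y := by
  have h1 := (tendsto_relabel hf x).mul (tendsto_relabel hf y)
  have h2 : Tendsto (fun n => shift A f n * (x * (y - shift A id n * y)) * star (shift A f n))
      atTop (𝓝 0) := by
    refine squeeze_zero_norm (fun n => norm_conj_le (norm_shift_le hf n)) ?_
    have h3 : Tendsto (fun n => x * (y - shift A id n * y)) atTop (𝓝 (x * (y - y))) :=
      (tendsto_const_nhds.sub (tendsto_proj_mul y)).const_mul x
    simpa using h3.norm
  have h4 := h1.add h2
  rw [add_zero] at h4
  refine tendsto_nhds_unique (tendsto_relabel hf _) (h4.congr fun n => ?_)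
  have h5 : shift A f n * x * star (shift A f n) * (shift A f n * y * star (shift A f n)) =
      shift A f n * x * (star (shift A f n) * shift A f n) * y * star (shift A f n) := by
    simp only [mul_assoc]
  rw [h5, star_shift_mul_shift hf le_rfl]
  simp only [mul_sub, sub_mul, mul_assoc]
  abel

theorem star_shift_mul_relabel (hf : f.Injective) (n : ℕ) (x : Stab A) :
    star (shift A f n) * relabel f x * shift A f n = shift A id n * x * shift A id n := by
  refine tendsto_nhds_unique
    (((tendsto_relabel hf x).const_mul (star (shift A f n))).mul_const (shift A f n))
    ((tendsto_congr' ?_).2 tendsto_const_nhds)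
  filter_upwards [eventually_ge_atTop n] with m hm
  have h1 : star (shift A f n) * shift A f m = shift A id n := by
    have := congrArg star (star_shift_mul_shift (A := A) hf hm)
    simpa [star_proj] using this
  calc star (shift A f n) * (shift A f m * x * star (shift A f m)) * shift A f n
      = (star (shift A f n) * shift A f m) * x * (star (shift A f m) * shift A f n) := by
        simp only [mul_assoc]
    _ = _ := by rw [h1, star_shift_mul_shift hf hm]

theorem star_shift_mul_relabel_of_disjoint (hf : f.Injective) (h : ∀ i j, g i ≠ f j) (n : ℕ)
    (x : Stab A) : star (shift A g n) * relabel f x = 0 := by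
  refine tendsto_nhds_unique ((tendsto_relabel hf x).const_mul (star (shift A g n)))
    (tendsto_const_nhds.congr fun m => ?_)
  rw [← mul_assoc, ← mul_assoc, star_shift_mul_shift_of_disjoint h, zero_mul, zero_mul]

theorem relabel_mul_of_disjoint (hf : f.Injective) (hg : g.Injective) (h : ∀ i j, f i ≠ g j)
    (x y : Stab A) : relabel f x * relabel g y = 0 := by
  refine tendsto_nhds_unique ((tendsto_relabel hf x).mul_const (relabel g y))
    (tendsto_const_nhds.congr fun m => ?_)
  rw [mul_assoc, star_shift_mul_relabel_of_disjoint hg h, mul_zero]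

theorem relabel_comp (hf : f.Injective) (hg : g.Injective) (x : Stab A) :
    relabel f (relabel g x) = relabel (f ∘ g) x := by
  have hshift : ∀ n, ∃ M, ∀ m, M ≤ m → shift A f m * shift A g n = shift A (f ∘ g) n := by
    intro n
    refine ⟨(Finset.range n).sup g + 1, fun m hm => ?_⟩
    rw [shift, shift, Finset.sum_mul_sum, Finset.sum_comm, shift]
    refine Finset.sum_congr rfl fun j hj => ?_
    rw [Finset.sum_eq_single (g j)]
    · simp [single_mul_single]
    · intro i _ hij
      rw [single_mul_single, if_neg hij]
    · intro h'
      have := Finset.le_sup (f := g) hj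
      exact absurd (Finset.mem_range.2 (by omega)) h'
  have hn : ∀ n, relabel f (shift A g n * x * star (shift A g n)) =
      shift A (f ∘ g) n * x * star (shift A (f ∘ g) n) := by
    intro n
    obtain ⟨M, hM⟩ := hshift n
    refine tendsto_nhds_unique (tendsto_relabel hf _) ((tendsto_congr' ?_).2 tendsto_const_nhds)
    filter_upwards [eventually_ge_atTop M] with m hm
    rw [← hM m hm, star_mul]
    simp only [mul_assoc]
  have hlim : Tendsto (fun n => relabel f (shift A g n * x * star (shift A g n))) atTop
      (𝓝 (relabel f (relabel g x))) := by
    rw [tendsto_iff_norm_sub_tendsto_zero]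
    refine squeeze_zero (fun _ => norm_nonneg _) (fun n => ?_)
      (tendsto_iff_norm_sub_tendsto_zero.1 (tendsto_relabel hg x))
    rw [← relabel_sub hf]
    exact norm_relabel_le hf _
  exact tendsto_nhds_unique hlim
    ((tendsto_relabel (hf.comp hg) x).congr fun n => (hn n).symm)

end relabel

end Stab

end Stabilization

/-! ## The Cuntz semigroup -/

section Cuntz

variable {A : Type u} [CStarAlgebra A]

/-- Cuntz subequivalence `a ≾ b` in `A ⊗ 𝒦`: there are `xₙ` with `xₙ b xₙ⋆ → a`. -/
def CuntzLE (a b : Stab A) : Prop :=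
  ∀ ε : ℝ, 0 < ε → ∃ x : Stab A, ‖x * b * star x - a‖ < ε

theorem CuntzLE.refl (a : Stab A) : CuntzLE a a := by
  intro ε hε
  have h := Stab.tendsto_relabel Function.injective_id a
  rw [Stab.relabel_id, Metric.tendsto_nhds] at h
  obtain ⟨n, hn⟩ := (h ε hε).exists
  rw [dist_eq_norm] at hn
  exact ⟨_, hn⟩

theorem CuntzLE.trans {a b c : Stab A} (hab : CuntzLE a b) (hbc : CuntzLE b c) : CuntzLE a c := by
  intro ε hε
  obtain ⟨x, hx⟩ := hab (ε / 2) (half_pos hε)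
  have hpos : 0 < ‖x‖ * ‖x‖ + 1 := by positivity
  obtain ⟨y, hy⟩ := hbc (ε / 2 / (‖x‖ * ‖x‖ + 1)) (by positivity)
  refine ⟨x * y, ?_⟩
  have h1 : x * y * c * star (x * y) - a =
      x * (y * c * star y - b) * star x + (x * b * star x - a) := by
    simp only [star_mul, mul_sub, sub_mul, mul_assoc]
    abel
  rw [h1]
  have h2 : ‖x * (y * c * star y - b) * star x‖ ≤ ‖x‖ * ‖y * c * star y - b‖ * ‖x‖ := by
    simpa using (norm_mul_le (x * (y * c * star y - b)) (star x)).trans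
      (mul_le_mul_of_nonneg_right (norm_mul_le _ _) (norm_nonneg _))
  rw [lt_div_iff₀ hpos] at hy
  have h3 := norm_add_le (x * (y * c * star y - b) * star x) (x * b * star x - a)
  nlinarith [norm_nonneg (y * c * star y - b)]

theorem CuntzLE.of_tendsto {a b : Stab A} (x : ℕ → Stab A)
    (h : Tendsto (fun n => x n * b * star (x n)) atTop (𝓝 a)) : CuntzLE a b := by
  intro ε hε
  obtain ⟨n, hn⟩ := (Metric.tendsto_nhds.1 h ε hε).exists
  rw [dist_eq_norm] at hn
  exact ⟨_, hn⟩

/-- Orthogonal sums of relabelled copies do not depend on the relabellings, up to Cuntz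
equivalence. -/
theorem CuntzLE.sum_relabel {J : Type} [Fintype J] (f g : J → ℕ → ℕ)
    (hf : ∀ j, (f j).Injective) (hg : ∀ j, (g j).Injective)
    (hg' : ∀ j k, j ≠ k → ∀ m n, g j m ≠ g k n) (a : J → Stab A) :
    CuntzLE (∑ j, Stab.relabel (f j) (a j)) (∑ j, Stab.relabel (g j) (a j)) := by
  have hX : ∀ n j, star (Stab.shift A (g j) n) * (∑ k, Stab.relabel (g k) (a k)) =
      star (Stab.shift A (g j) n) * Stab.relabel (g j) (a j) := by
    intro n j
    rw [Finset.mul_sum, Finset.sum_eq_single j]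
    · intro k _ hk
      exact Stab.star_shift_mul_relabel_of_disjoint (hg k) (fun m n => hg' j k hk.symm m n) n _
    · simp
  have hY : ∀ n j k, j ≠ k → Stab.relabel (g j) (a j) * Stab.shift A (g k) n = 0 := by
    intro n j k hjk
    have h := Stab.star_shift_mul_relabel_of_disjoint (hg j)
      (fun m n => hg' k j hjk.symm m n) n (star (a j))
    rw [Stab.relabel_star (hg j), ← star_mul] at h
    exact star_eq_zero.1 h
  refine CuntzLE.of_tendsto
    (fun n => ∑ j, Stab.shift A (f j) n * star (Stab.shift A (g j) n)) ?_
  refine (tendsto_finsetSum _ fun j _ => Stab.tendsto_relabel (hf j) (a j)).congr fun n => ?_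
  rw [Finset.sum_mul, star_sum, Finset.sum_mul]
  refine Finset.sum_congr rfl fun j _ => ?_
  rw [Finset.mul_sum, Finset.sum_eq_single j]
  · calc Stab.shift A (f j) n * a j * star (Stab.shift A (f j) n)
        = (Stab.shift A (f j) n * Stab.shift A id n) * a j *
            star (Stab.shift A (f j) n * Stab.shift A id n) := by
          rw [Stab.shift_mul_proj _ le_rfl]
      _ = Stab.shift A (f j) n * (star (Stab.shift A (g j) n) * Stab.relabel (g j) (a j) *
            Stab.shift A (g j) n) * star (Stab.shift A (f j) n) := by
          rw [Stab.star_shift_mul_relabel (hg j), star_mul, Stab.star_proj]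
          simp only [mul_assoc]
      _ = _ := by
          rw [mul_assoc (Stab.shift A (f j) n) _ (∑ k, Stab.relabel (g k) (a k)), hX, star_mul,
            star_star]
          simp only [mul_assoc]
  · intro k _ hk
    rw [mul_assoc (Stab.shift A (f j) n) _ (∑ k, Stab.relabel (g k) (a k)), hX, star_mul,
      star_star]
    have := hY n j k hk.symm
    rw [mul_assoc, mul_assoc, ← mul_assoc (Stab.relabel (g j) (a j)), this]
    simp
  · simp

variable (A) in
/-- The set of positive elements of `A ⊗ 𝒦`. -/
structure PosElt : Type u where
  /-- The underlying element of `A ⊗ 𝒦`. -/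
  val : Stab A
  pos : ∃ b, val = star b * b

instance instPreorderPosElt : Preorder (PosElt A) where
  le a b := CuntzLE a.1 b.1
  le_refl a := CuntzLE.refl a.1
  le_trans _ _ _ h₁ h₂ := CuntzLE.trans h₁ h₂

variable (A) in
/-- The Cuntz semigroup `Cu(A)`: Cuntz equivalence classes of positive elements of `A ⊗ 𝒦`, where
`a ∼ b` if `a ≾ b` and `b ≾ a`, ordered by Cuntz subequivalence. -/
def Cu : Type u := Antisymmetrization (PosElt A) (· ≤ ·)

instance instPartialOrderCu : PartialOrder (Cu A) :=
  inferInstanceAs (PartialOrder (Antisymmetrization (PosElt A) (· ≤ ·)))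

/-- The Cuntz class `⟨a⟩` of a positive element `a` of `A ⊗ 𝒦`. -/
def Cu.mk (a : PosElt A) : Cu A := toAntisymmetrization (· ≤ ·) a

theorem Cu.mk_le_mk {a b : PosElt A} : Cu.mk a ≤ Cu.mk b ↔ CuntzLE a.1 b.1 := Iff.rfl

theorem Cu.ind {p : Cu A → Prop} (h : ∀ a, p (Cu.mk a)) (x : Cu A) : p x :=
  Quotient.inductionOn x h

/-- The injection `n ↦ 2n`. -/
def ev (n : ℕ) : ℕ := 2 * n

/-- The injection `n ↦ 2n + 1`. -/
def od (n : ℕ) : ℕ := 2 * n + 1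

theorem ev_injective : ev.Injective := fun m n h => by simp only [ev] at h; omega
theorem od_injective : od.Injective := fun m n h => by simp only [od] at h; omega
theorem ev_ne_od (m n : ℕ) : ev m ≠ od n := by simp only [ev, od]; omega

/-- The orthogonal sum `a ⊕ b` of two positive elements of `A ⊗ 𝒦`, formed in `A ⊗ 𝒦` through the
identification of `ℕ` with two disjoint copies of itself. -/
def PosElt.oplus (a b : PosElt A) : PosElt A :=
  ⟨Stab.relabel ev a.1 + Stab.relabel od b.1, by
    obtain ⟨_, x, rfl⟩ := a
    obtain ⟨_, y, rfl⟩ := b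
    refine ⟨Stab.relabel ev x + Stab.relabel od y, ?_⟩
    have h1 : star (Stab.relabel ev x) * Stab.relabel od y = 0 := by
      rw [← Stab.relabel_star ev_injective]
      exact Stab.relabel_mul_of_disjoint ev_injective od_injective ev_ne_od _ _
    have h2 : star (Stab.relabel od y) * Stab.relabel ev x = 0 := by
      rw [← Stab.relabel_star od_injective]
      exact Stab.relabel_mul_of_disjoint od_injective ev_injective
        (fun i j => (ev_ne_od j i).symm) _ _
    rw [star_add, add_mul, mul_add, mul_add, h1, h2, Stab.relabel_mul ev_injective,
      Stab.relabel_mul od_injective, Stab.relabel_star ev_injective,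
      Stab.relabel_star od_injective, add_zero, zero_add]⟩

theorem PosElt.oplus_le_oplus {a a' b b' : PosElt A} (ha : a ≤ a') (hb : b ≤ b') :
    a.oplus b ≤ a'.oplus b' := by
  intro ε hε
  obtain ⟨x, hx⟩ := ha (ε / 2) (half_pos hε)
  obtain ⟨y, hy⟩ := hb (ε / 2) (half_pos hε)
  refine ⟨Stab.relabel ev x + Stab.relabel od y, ?_⟩
  have hoe : ∀ i j, od i ≠ ev j := fun i j => (ev_ne_od j i).symm
  have h1 : (Stab.relabel ev x + Stab.relabel od y) * (a'.oplus b').1 *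
        star (Stab.relabel ev x + Stab.relabel od y) - (a.oplus b).1 =
      Stab.relabel ev (x * a'.1 * star x - a.1) + Stab.relabel od (y * b'.1 * star y - b.1) := by
    change (Stab.relabel ev x + Stab.relabel od y) * (Stab.relabel ev a'.1 + Stab.relabel od b'.1) *
        star (Stab.relabel ev x + Stab.relabel od y) -
        (Stab.relabel ev a.1 + Stab.relabel od b.1) = _
    rw [Stab.relabel_sub ev_injective, Stab.relabel_sub od_injective,
      Stab.relabel_mul ev_injective, Stab.relabel_mul od_injective,
      Stab.relabel_mul ev_injective, Stab.relabel_mul od_injective, star_add,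
      ← Stab.relabel_star ev_injective, ← Stab.relabel_star od_injective]
    simp only [add_mul, mul_add, mul_assoc,
      Stab.relabel_mul_of_disjoint ev_injective od_injective ev_ne_od,
      Stab.relabel_mul_of_disjoint od_injective ev_injective hoe, mul_zero, add_zero, zero_add]
    abel
  rw [h1]
  have h2 := norm_add_le (Stab.relabel ev (x * a'.1 * star x - a.1))
    (Stab.relabel od (y * b'.1 * star y - b.1))
  have h3 := Stab.norm_relabel_le ev_injective (x * a'.1 * star x - a.1)
  have h4 := Stab.norm_relabel_le od_injective (y * b'.1 * star y - b.1)
  linarith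

/-- Addition in the Cuntz semigroup: `⟨a⟩ + ⟨b⟩ = ⟨a ⊕ b⟩`. -/
instance instAddCu : Add (Cu A) where
  add := Quotient.map₂ PosElt.oplus fun _ _ h _ _ h' =>
    ⟨PosElt.oplus_le_oplus h.1 h'.1, PosElt.oplus_le_oplus h.2 h'.2⟩

theorem Cu.mk_add_mk (a b : PosElt A) : Cu.mk a + Cu.mk b = Cu.mk (a.oplus b) := rfl

instance instZeroCu : Zero (Cu A) where
  zero := Cu.mk ⟨0, 0, by simp⟩

theorem Cu.zero_def : (0 : Cu A) = Cu.mk ⟨0, 0, by simp⟩ := rfl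

theorem Cu.add_comm' (x y : Cu A) : x + y ≤ y + x := by
  induction x using Cu.ind with | _ a
  induction y using Cu.ind with | _ b
  rw [Cu.mk_add_mk, Cu.mk_add_mk, Cu.mk_le_mk]
  have h := CuntzLE.sum_relabel (A := A) ![ev, od] ![od, ev]
    (by simp [Fin.forall_fin_two, ev_injective, od_injective])
    (by simp [Fin.forall_fin_two, ev_injective, od_injective])
    (by
      simp only [Fin.forall_fin_two]
      refine ⟨⟨by simp, fun _ m n => (ev_ne_od n m).symm⟩, fun _ m n => ev_ne_od m n, by simp⟩)
    ![a.1, b.1]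
  simp only [Fin.sum_univ_two] at h
  refine h.trans ?_
  rw [add_comm]
  exact CuntzLE.refl _

theorem Cu.zero_add' (x : Cu A) : 0 + x = x := by
  induction x using Cu.ind with | _ a
  have h0 : (PosElt.oplus ⟨0, 0, by simp⟩ a).1 = Stab.relabel od a.1 := by
    change Stab.relabel ev 0 + Stab.relabel od a.1 = _
    rw [Stab.relabel_zero ev_injective, zero_add]
  rw [Cu.zero_def, Cu.mk_add_mk]
  apply le_antisymm
  · rw [Cu.mk_le_mk, h0]
    have h := CuntzLE.sum_relabel (A := A) (fun _ : Unit => od) (fun _ => id)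
      (fun _ => od_injective) (fun _ => Function.injective_id)
      (fun j k hjk => absurd (Subsingleton.elim j k) hjk) (fun _ => a.1)
    simpa [Stab.relabel_id] using h
  · rw [Cu.mk_le_mk, h0]
    have h := CuntzLE.sum_relabel (A := A) (fun _ : Unit => id) (fun _ => od)
      (fun _ => Function.injective_id) (fun _ => od_injective)
      (fun j k hjk => absurd (Subsingleton.elim j k) hjk) (fun _ => a.1)
    simpa [Stab.relabel_id] using h

theorem Cu.add_assoc' (x y z : Cu A) : x + y + z = x + (y + z) := by
  induction x using Cu.ind with | _ a
  induction y using Cu.ind with | _ b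
  induction z using Cu.ind with | _ c
  have hl : ((a.oplus b).oplus c).1 = Stab.relabel (ev ∘ ev) a.1 + Stab.relabel (ev ∘ od) b.1 +
      Stab.relabel od c.1 := by
    change Stab.relabel ev (Stab.relabel ev a.1 + Stab.relabel od b.1) + Stab.relabel od c.1 = _
    rw [Stab.relabel_add ev_injective, Stab.relabel_comp ev_injective ev_injective,
      Stab.relabel_comp ev_injective od_injective]
  have hr : (a.oplus (b.oplus c)).1 = Stab.relabel ev a.1 + Stab.relabel (od ∘ ev) b.1 +
      Stab.relabel (od ∘ od) c.1 := by
    change Stab.relabel ev a.1 + Stab.relabel od (Stab.relabel ev b.1 + Stab.relabel od c.1) = _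
    rw [Stab.relabel_add od_injective, Stab.relabel_comp od_injective ev_injective,
      Stab.relabel_comp od_injective od_injective, add_assoc]
  have i1 : ∀ j, (![ev ∘ ev, ev ∘ od, od] j).Injective := by
    simp [Fin.forall_fin_succ, ev_injective, od_injective, ev_injective.comp]
  have i2 : ∀ j, (![ev, od ∘ ev, od ∘ od] j).Injective := by
    simp [Fin.forall_fin_succ, ev_injective, od_injective, od_injective.comp]
  have d1 : ∀ j k, j ≠ k → ∀ m n, ![ev ∘ ev, ev ∘ od, od] j m ≠ ![ev ∘ ev, ev ∘ od, od] k n := by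
    intro j k hjk m n
    fin_cases j <;> fin_cases k <;> simp [ev, od] at hjk ⊢ <;> omega
  have d2 : ∀ j k, j ≠ k → ∀ m n, ![ev, od ∘ ev, od ∘ od] j m ≠ ![ev, od ∘ ev, od ∘ od] k n := by
    intro j k hjk m n
    fin_cases j <;> fin_cases k <;> simp [ev, od] at hjk ⊢ <;> omega
  simp only [Cu.mk_add_mk]
  apply le_antisymm
  · rw [Cu.mk_le_mk, hl, hr]
    have h := CuntzLE.sum_relabel (A := A) _ _ i1 i2 d2 ![a.1, b.1, c.1]
    simpa [Fin.sum_univ_three] using h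
  · rw [Cu.mk_le_mk, hl, hr]
    have h := CuntzLE.sum_relabel (A := A) _ _ i2 i1 d1 ![a.1, b.1, c.1]
    simpa [Fin.sum_univ_three] using h

instance instAddCommMonoidCu : AddCommMonoid (Cu A) where
  add_assoc := Cu.add_assoc'
  zero_add := Cu.zero_add'
  add_zero x := (le_antisymm (Cu.add_comm' x 0) (Cu.add_comm' 0 x)).trans (Cu.zero_add' x)
  add_comm x y := le_antisymm (Cu.add_comm' x y) (Cu.add_comm' y x)
  nsmul := nsmulRec

variable (A) in
/-- The class `⟨1_A⟩` of the unit of `A` in `Cu(A)`, with `A` embedded in `A ⊗ 𝒦` through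
`a ↦ a ⊗ e₀₀`. -/
def unitClass : Cu A :=
  Cu.mk ⟨Stab.single 0 0 1, Stab.single 0 0 1, by simp [Stab.star_single, Stab.single_mul_single]⟩

end Cuntz

/-! ## Divisibility numbers -/

section Divisibility

variable {S : Type u} [PartialOrder S] [AddCommMonoid S]

/-- Compact containment `u ≪ v`: whenever `v = sup vᵢ` for an increasing sequence `(vᵢ)`, then
`u ≤ vᵢ` for some `i`. -/
def CompactlyContained (u v : S) : Prop :=
  ∀ w : ℕ → S, Monotone w → IsLUB (Set.range w) v → ∃ i, u ≤ w i

/-- `u` is `(m, n)`-divisible. -/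
def IsDivisible (m n : ℕ) (u : S) : Prop :=
  ∀ u', CompactlyContained u' u → ∃ x : S, m • x ≤ u ∧ u' ≤ n • x

/-- `u` is `(m, n)`-decomposable. -/
def IsDecomposable (m n : ℕ) (u : S) : Prop :=
  ∀ u', CompactlyContained u' u → ∃ x : Fin m → S, ∑ j, x j ≤ u ∧ ∀ j, u' ≤ n • x j

/-- `u` is weakly `(m, n)`-divisible. -/
def IsWeaklyDivisible (m n : ℕ) (u : S) : Prop :=
  ∀ u', CompactlyContained u' u → ∃ x : Fin n → S, (∀ j, m • x j ≤ u) ∧ u' ≤ ∑ j, x j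

end Divisibility

section Numbers

/-- The least integer `n ≥ 1` with `p n`, and `∞` if there is none. -/
def leastPos (p : ℕ → Prop) : ℕ∞ := sInf {N : ℕ∞ | ∃ n : ℕ, 1 ≤ n ∧ p n ∧ N = n}

/-- The number `Div_m(A)`, the least `n ≥ 1` such that `⟨1_A⟩` is `(m, n)`-divisible. -/
def bigDiv (m : ℕ) (A : Type u) [CStarAlgebra A] : ℕ∞ :=
  leastPos fun n => IsDivisible m n (unitClass A)

/-- The number `∂iv_m(A)`, the least `n ≥ 1` such that `⟨1_A⟩` is `(m, n)`-decomposable. -/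
def decDiv (m : ℕ) (A : Type u) [CStarAlgebra A] : ℕ∞ :=
  leastPos fun n => IsDecomposable m n (unitClass A)

/-- The number `div_m(A)`, the least `n ≥ 1` such that `⟨1_A⟩` is weakly `(m, n)`-divisible. -/
def weakDiv (m : ℕ) (A : Type u) [CStarAlgebra A] : ℕ∞ :=
  leastPos fun n => IsWeaklyDivisible m n (unitClass A)

end Numbers

end CuntzDiv

end

/-! The class `⟨1⟩` is compact (`compactlyContained_unitClass`), so in all three definitions the
quantifier over `u' ≪ ⟨1⟩` can be replaced by the single choice `u' = ⟨1⟩`. Each property then asks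
whether a finite system of inequalities `∑ xᵢ ≤ ⟨1⟩` and `⟨1⟩ ≤ ∑ xᵢ` has a solution in the Cuntz
semigroup; this common form is `Solvable`, and the three properties differ only in which unknowns
occur where.

The semigroup of a product is hard to compare with those of the factors, so solvability is moved
into the algebra. A system is solvable exactly when there are elements `c`, `h`, `w` of `A` itself,
bounded by a universal constant, that satisfy finitely many norm relations up to an error `ε`, and
`ε` depends only on the lengths `m`, `n` of the sums, never on the algebra. One direction is
`Solvable.approxSolvable`: arbitrary, possibly unbounded Cuntz witnesses are normalized through
functional calculus until norm 2 suffices. The other is `exists_solvable_of_approxSolvable`: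
approximate relations are repaired by cutting the positive elements down slightly, because a small
perturbation of a positive element dominates its truncation.

Bounded families satisfying norm inequalities with uniform constants are exactly what bounded
products and their quotients transport: coordinatewise for the product, and for almost all
coordinates, at the price of a little room in the constants, for the quotient along a filter. This
gives `solvable_bprod_iff` and `solvable_rprod_iff`. Since each property persists when `n` grows, a
number is at most `n` exactly when the property holds at `n`, and the equivalences turn into the
formulas with `sup` and `limsup`. -/

noncomputable section

namespace CuntzDiv

universe u

/-! ### Approximate conjugation of positive elements in a unital algebra -/

section Conjugation

variable {M : Type u} [CStarAlgebra M] [PartialOrder M] [StarOrderedRing M]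

/-- Larger positive elements dominate smaller ones in the Cuntz order. -/
theorem exists_conj_of_le {a b : M} (ha : 0 ≤ a) (hab : a ≤ b) {ε : ℝ} (hε : 0 < ε) :
    ∃ x : M, ‖x * b * star x - a‖ < ε := by
  have hb : 0 ≤ b := ha.trans hab
  set δ := ε / 2 with hδ
  have hδ0 : 0 < δ := half_pos hε
  -- `k = (b + δ)^(-1/2)`. With `x = a^(1/2) k` the defect `x b x⋆ - a` equals `-δ x x⋆`, and `‖x
  -- x⋆‖ = ‖k a k‖ ≤ ‖k b k‖ ≤ 1`.
  set k : M := cfc (fun t : ℝ => 1 / √(t + δ)) b with hk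
  have hcont : ContinuousOn (fun t : ℝ => 1 / √(t + δ)) (spectrum ℝ b) := by
    refine ContinuousOn.div continuousOn_const (by fun_prop) fun t ht => ?_
    have : 0 ≤ t := spectrum_nonneg_of_nonneg hb ht
    positivity
  have hks : IsSelfAdjoint k := cfc_predicate _ _
  have hone : k * b * k + δ • (k * k) = 1 := by
    have h1 : k * b * k = cfc (fun t : ℝ => 1 / √(t + δ) * t * (1 / √(t + δ))) b := by
      rw [cfc_mul (fun t : ℝ => 1 / √(t + δ) * t) _ b (by fun_prop) hcont,
        cfc_mul _ (fun t : ℝ => t) b hcont (by fun_prop), cfc_id' ℝ b]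
    have h2 : δ • (k * k) = cfc (fun t : ℝ => δ • (1 / √(t + δ) * (1 / √(t + δ)))) b := by
      rw [cfc_smul δ _ b (by fun_prop), cfc_mul _ _ b hcont hcont]
    rw [h1, h2, ← cfc_add b _ _ (by fun_prop) (by fun_prop), ← cfc_one ℝ b]
    refine cfc_congr fun t ht => ?_
    have ht0 : 0 ≤ t := spectrum_nonneg_of_nonneg hb ht
    have hs : √(t + δ) * √(t + δ) = t + δ := Real.mul_self_sqrt (by positivity)
    have hp : 0 < √(t + δ) := by positivity
    simp only [smul_eq_mul, Pi.one_apply]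
    field_simp
    nlinarith
  have hkbk : ‖k * b * k‖ ≤ 1 := by
    rw [CStarAlgebra.norm_le_one_iff_of_nonneg _ (hks.conjugate_nonneg hb), ← hone]
    refine le_add_of_nonneg_right (smul_nonneg hδ0.le ?_)
    simpa [hks.star_eq] using star_mul_self_nonneg k
  have hkak : ‖k * a * k‖ ≤ 1 :=
    (CStarAlgebra.norm_le_norm_of_nonneg_of_le (hks.conjugate_nonneg ha)
      (hks.conjugate_le_conjugate hab)).trans hkbk
  set s := CFC.sqrt a
  have hs : IsSelfAdjoint s := (CFC.sqrt_nonneg a).isSelfAdjoint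
  have hss : s * s = a := CFC.sqrt_mul_sqrt_self a ha
  refine ⟨s * k, ?_⟩
  have h1 : s * k * b * star (s * k) - a = -(δ • (s * k * star (s * k))) := by
    rw [star_mul, hs.star_eq, hks.star_eq]
    have : a = s * (k * b * k + δ • (k * k)) * s := by rw [hone, mul_one, hss]
    rw [this]
    simp only [mul_add, add_mul, mul_assoc, mul_smul_comm, smul_mul_assoc]
    abel
  have h2 : ‖s * k * star (s * k)‖ = ‖k * a * k‖ := by
    rw [CStarRing.norm_self_mul_star, ← CStarRing.norm_star_mul_self, star_mul, hs.star_eq,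
      hks.star_eq, ← hss]
    simp only [mul_assoc]
  rw [h1, norm_neg, norm_smul, h2, Real.norm_of_nonneg hδ0.le]
  nlinarith

/-- The norm estimate forces `1/2 ≤ r`, so the comparison of ordered positive elements reaches
`1/2`, and rescaling the conjugator by `√2` reaches `1`. The fixed tolerance `1/2` is what makes
approximate lower estimates of the unit self-improving. -/
theorem exists_conj_one {r : M} (hr : IsSelfAdjoint r) (h : ‖r - 1‖ ≤ 1 / 2) {ε : ℝ} (hε : 0 < ε) :
    ∃ x : M, ‖x * r * star x - 1‖ < ε := by
  have h1 : (1 / 2 : ℝ) • (1 : M) ≤ r := by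
    have h2 : -(r - 1) ≤ algebraMap ℝ M ‖-(r - 1)‖ :=
      IsSelfAdjoint.le_algebraMap_norm_self ((hr.sub (IsSelfAdjoint.one M)).neg)
    have h3 : algebraMap ℝ M ‖-(r - 1)‖ ≤ algebraMap ℝ M (1 / 2) := by
      rw [norm_neg]; exact algebraMap_mono M h
    have h4 := h2.trans h3
    rw [Algebra.algebraMap_eq_smul_one, neg_sub, sub_le_iff_le_add] at h4
    have h5 : (1 / 2 : ℝ) • (1 : M) + (1 / 2 : ℝ) • (1 : M) = 1 := by
      rw [← add_smul]; norm_num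
    exact (eq_sub_of_add_eq h5).le.trans (sub_le_iff_le_add'.2 h4)
  obtain ⟨x, hx⟩ := exists_conj_of_le (smul_nonneg (by norm_num) zero_le_one) h1 (half_pos hε)
  refine ⟨√2 • x, ?_⟩
  have h2 : √2 • x * r * star (√2 • x) - 1 = (2 : ℝ) • (x * r * star x - (1 / 2 : ℝ) • (1 : M)) := by
    rw [star_smul, smul_mul_assoc, smul_mul_assoc, mul_smul_comm, smul_smul]
    simp [smul_sub, smul_smul]
  rw [h2, norm_smul]
  norm_num
  norm_num at hx
  linarith

end Conjugation

/-! ### Conjugates close to a subequivalent element -/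

section Limits

variable {A : Type u} [CStarAlgebra A]

theorem Stab.tendsto_conj_proj (x : Stab A) :
    Tendsto (fun n => shift A id n * x * shift A id n) atTop (𝓝 x) := by
  have := tendsto_relabel Function.injective_id x
  simpa [relabel_id, star_proj] using this

theorem Stab.star_shift_add_mul_proj (n M : ℕ) :
    star (shift A (fun i => i + n) M) * shift A id n = 0 := by
  rw [star_shift, shift, Finset.sum_mul_sum]
  refine Finset.sum_eq_zero fun i _ => Finset.sum_eq_zero fun j hj => ?_
  rw [single_mul_single, if_neg]
  have := Finset.mem_range.1 hj
  simp only [id]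
  omega

theorem CuntzLE.conj (x b : Stab A) : CuntzLE (x * b * star x) b :=
  fun ε hε => ⟨x, by simpa using hε⟩

theorem isOpen_conj_lt (a : Stab A) (ε : ℝ) : IsOpen {c : Stab A | ∃ x, ‖x * c * star x - a‖ < ε} := by
  have : {c : Stab A | ∃ x, ‖x * c * star x - a‖ < ε} =
      ⋃ x, {c : Stab A | ‖x * c * star x - a‖ < ε} := by ext; simp
  rw [this]
  exact isOpen_iUnion fun x => isOpen_lt (by fun_prop) continuous_const

/-- If `b ≾ c` then `b` is approximated by conjugates of `c` that nearly dominate `c`. -/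
theorem CuntzLE.exists_near {b c : Stab A} (h : CuntzLE b c) {U V : Set (Stab A)}
    (hU : IsOpen U) (hbU : b ∈ U) (hV : IsOpen V) (hcV : c ∈ V) :
    ∃ v t : Stab A, v * c * star v ∈ U ∧ t * (v * c * star v) * star t ∈ V := by
  obtain ⟨ε, hε, hεU⟩ := Metric.isOpen_iff.1 hU b hbU
  obtain ⟨x, hx⟩ := h ε hε
  have hxU : x * c * star x ∈ U := hεU (by rwa [Metric.mem_ball, dist_eq_norm])
  obtain ⟨n, hn⟩ := ((Stab.tendsto_conj_proj (x * c * star x)).eventually (hU.mem_nhds hxU)).exists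
  obtain ⟨M, hM⟩ := ((Stab.tendsto_conj_proj c).eventually (hV.mem_nhds hcV)).exists
  -- `y` uses only the first `n` rows, while `S` shifts by `n` into the free rows below. Conjugating
  -- by `y + r S` with `r` small stays near `b`, yet `r⁻¹ S⋆` recovers the compression of `c` to a
  -- large block, however small `r` is.
  set y := Stab.shift A id n * x with hy
  set S := Stab.shift A (fun i => i + n) M with hS
  have hSy : star S * y = 0 := by
    rw [hy, ← mul_assoc, Stab.star_shift_add_mul_proj, zero_mul]
  have hSS : star S * S = Stab.shift A id M :=
    Stab.star_shift_mul_shift (add_left_injective n) le_rfl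
  have hcont : Continuous fun r : ℂ => (y + r • S) * c * star (y + r • S) := by fun_prop
  have h0 : (y + (0 : ℂ) • S) * c * star (y + (0 : ℂ) • S) ∈ U := by
    rw [zero_smul, add_zero, hy, star_mul, Stab.star_proj]
    simpa only [mul_assoc] using show _ ∈ U from hn
  have hev : ∀ᶠ r : ℂ in 𝓝[≠] 0, (y + r • S) * c * star (y + r • S) ∈ U :=
    (hcont.continuousAt.eventually (hU.mem_nhds h0)).filter_mono nhdsWithin_le_nhds
  obtain ⟨r, hrU, hr⟩ := (hev.and self_mem_nhdsWithin).exists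
  refine ⟨y + r • S, r⁻¹ • star S, hrU, ?_⟩
  have h1 : (r⁻¹ • star S) * (y + r • S) = Stab.shift A id M := by
    rw [mul_add, smul_mul_assoc, hSy, smul_zero, zero_add, smul_mul_smul_comm, hSS,
      inv_mul_cancel₀ hr, one_smul]
  have h2 : r⁻¹ • star S * ((y + r • S) * c * star (y + r • S)) * star (r⁻¹ • star S) =
      (r⁻¹ • star S * (y + r • S)) * c * star (r⁻¹ • star S * (y + r • S)) := by
    simp only [star_mul, mul_assoc]
  rw [h2, h1, Stab.star_proj]
  exact hM

end Limits

/-! ### Upper bounds of increasing sequences as norm limits -/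

section Suprema

variable {A : Type u} [CStarAlgebra A]

attribute [local instance] CStarAlgebra.spectralOrder CStarAlgebra.spectralOrderedRing

/-- The positive cone is closed; this makes the limit constructed next a legitimate representative.
-/
theorem exists_star_mul_self_of_tendsto {b : ℕ → Stab A} {a : Stab A}
    (hb : ∀ n, ∃ c, b n = star c * c) (h : Tendsto b atTop (𝓝 a)) : ∃ c, a = star c * c := by
  rw [← CStarAlgebra.nonneg_iff_eq_star_mul_self]
  exact ge_of_tendsto' h fun n => CStarAlgebra.nonneg_iff_eq_star_mul_self.2 (hb n)

/-- An increasing sequence in the Cuntz semigroup has an upper bound that is a norm limit of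
elements dominated by members of the sequence. -/
theorem exists_upper_bound (a : ℕ → PosElt A) (ha : ∀ n, CuntzLE (a n).1 (a (n + 1)).1) :
    ∃ (s : PosElt A) (b : ℕ → PosElt A), (∀ n, a n ≤ s) ∧ (∀ n, b n ≤ a n) ∧
      Tendsto (fun n => (b n).1) atTop (𝓝 s.1) := by
  have hmono : Monotone a := monotone_nat_of_le_succ ha
  -- `G N` collects the elements that dominate `a 0, …, a N` up to the error `1 / (N + 1)`. These
  -- sets are open, and they contain an element as soon as they contain one of its conjugates, so a
  -- limit lying in every `G N` is an upper bound of the sequence.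
  let G : ℕ → Set (Stab A) := fun N =>
    ⋂ i ∈ Finset.range (N + 1), {c | ∃ x, ‖x * c * star x - (a i).1‖ < 1 / ((N : ℝ) + 1)}
  have hGo : ∀ N, IsOpen (G N) := fun N =>
    isOpen_biInter_finset fun i _ => isOpen_conj_lt _ _
  have hGa : ∀ N, (a N).1 ∈ G N := fun N => by
    simp only [G, Set.mem_iInter]
    intro i hi
    exact hmono (Nat.lt_succ_iff.1 (Finset.mem_range.1 hi)) _ (by positivity)
  have hGc : ∀ N (c t : Stab A), t * c * star t ∈ G N → c ∈ G N := by
    intro N c t h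
    simp only [G, Set.mem_iInter] at h ⊢
    intro i hi
    obtain ⟨x, hx⟩ := h i hi
    refine ⟨x * t, ?_⟩
    simpa only [star_mul, mul_assoc] using hx
  have hstep : ∀ (N : ℕ) (b : Stab A) (δ : ℝ), ∃ b' : Stab A, CuntzLE b (a (N + 1)).1 → 0 < δ →
      dist b' b < δ ∧ (∃ v, b' = v * (a (N + 1)).1 * star v) ∧ b' ∈ G (N + 1) := by
    intro N b δ
    by_cases h : CuntzLE b (a (N + 1)).1 ∧ 0 < δ
    · obtain ⟨v, t, h1, h2⟩ := h.1.exists_near Metric.isOpen_ball (Metric.mem_ball_self h.2)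
        (hGo (N + 1)) (hGa (N + 1))
      exact ⟨_, fun _ _ => ⟨h1, ⟨v, rfl⟩, hGc _ _ _ h2⟩⟩
    · exact ⟨0, fun h1 h2 => absurd ⟨h1, h2⟩ h⟩
  have hrad : ∀ (N : ℕ) (b : Stab A), ∃ δ : ℝ, 0 < δ ∧ (b ∈ G N → Metric.closedBall b δ ⊆ G N) := by
    intro N b
    by_cases h : b ∈ G N
    · obtain ⟨δ, hδ, h1⟩ := Metric.nhds_basis_closedBall.mem_iff.1 ((hGo N).mem_nhds h)
      exact ⟨δ, hδ, fun _ => h1⟩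
    · exact ⟨1, one_pos, fun h' => absurd h' h⟩
  choose F hF using hstep
  choose R hR0 hR using hrad
  -- An element together with a radius whose closed ball lies in `G N`. Each step moves by less than
  -- half the radius and at least halves it, so the sequence is Cauchy and its limit stays in all
  -- the balls.
  let s : ℕ → Stab A × ℝ := fun n => Nat.rec ((a 0).1, R 0 (a 0).1)
    (fun N p => (F N p.1 (p.2 / 2), min (p.2 / 2) (R (N + 1) (F N p.1 (p.2 / 2))))) n
  have hs1 : ∀ N, (s (N + 1)).1 = F N (s N).1 ((s N).2 / 2) := fun _ => rfl
  have hs2 : ∀ N, (s (N + 1)).2 = min ((s N).2 / 2) (R (N + 1) (s (N + 1)).1) := fun _ => rfl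
  have hpos : ∀ N, 0 < (s N).2 := by
    intro N
    induction N with
    | zero => exact hR0 _ _
    | succ N ih => rw [hs2]; exact lt_min (half_pos ih) (hR0 _ _)
  have hle : ∀ N, CuntzLE (s N).1 (a N).1 ∧ (∃ c, (s N).1 = star c * c) ∧ (s N).1 ∈ G N := by
    intro N
    induction N with
    | zero => exact ⟨CuntzLE.refl _, (a 0).2, hGa 0⟩
    | succ N ih =>
      obtain ⟨_, ⟨v, hv⟩, h3⟩ := hF N (s N).1 ((s N).2 / 2) (ih.1.trans (ha N)) (half_pos (hpos N))
      rw [← hs1] at hv h3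
      refine ⟨hv ▸ CuntzLE.conj _ _, ?_, h3⟩
      obtain ⟨c, hc⟩ := (a (N + 1)).2
      refine ⟨c * star v, ?_⟩
      rw [hv, hc, star_mul, star_star]
      simp only [mul_assoc]
  have hdist : ∀ N, dist (s (N + 1)).1 (s N).1 < (s N).2 / 2 := fun N =>
    (hF N (s N).1 ((s N).2 / 2) ((hle N).1.trans (ha N)) (half_pos (hpos N))).1
  have hhalf : ∀ N, (s (N + 1)).2 ≤ (s N).2 / 2 := fun N => by rw [hs2]; exact min_le_left _ _
  have hrle : ∀ N, (s N).2 ≤ R N (s N).1 := by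
    rintro (_ | N)
    · exact le_rfl
    · rw [hs2]; exact min_le_right _ _
  have hgeo : ∀ N, (s N).2 ≤ (s 0).2 / 2 ^ N := by
    intro N
    induction N with
    | zero => simp
    | succ N ih =>
      refine (hhalf N).trans ?_
      rw [pow_succ, ← div_div]
      gcongr
  have hcau : CauchySeq fun N => (s N).1 := by
    refine cauchySeq_of_le_geometric_two (C := (s 0).2) fun N => ?_
    rw [dist_comm]
    refine (hdist N).le.trans ?_
    have := hgeo N
    rw [div_right_comm]
    linarith
  obtain ⟨l, hl⟩ := cauchySeq_tendsto_of_complete hcau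
  have htel : ∀ N k, dist (s (N + k)).1 (s N).1 ≤ (s N).2 - (s (N + k)).2 := by
    intro N k
    induction k with
    | zero => simp
    | succ k ih =>
      have h1 := dist_triangle (s (N + k + 1)).1 (s (N + k)).1 (s N).1
      have h2 := hdist (N + k)
      have h3 := hhalf (N + k)
      rw [← add_assoc]
      linarith
  have hlG : ∀ N, l ∈ G N := by
    intro N
    refine hR N _ (hle N).2.2 ?_
    rw [Metric.mem_closedBall]
    have h1 : Tendsto (fun k => dist (s (N + k)).1 (s N).1) atTop (𝓝 (dist l (s N).1)) := by
      have := (tendsto_add_atTop_iff_nat N).2 hl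
      exact (this.congr fun k => by rw [add_comm]).dist tendsto_const_nhds
    refine (le_of_tendsto' h1 fun k => ?_).trans (hrle N)
    have := hpos (N + k)
    linarith [htel N k]
  refine ⟨⟨l, exists_star_mul_self_of_tendsto (fun n => (hle n).2.1) hl⟩,
    fun n => ⟨(s n).1, (hle n).2.1⟩, fun i => ?_, fun n => (hle n).1, hl⟩
  intro ε hε
  obtain ⟨N, hN⟩ := exists_nat_one_div_lt hε
  have h1 := hlG (max i N)
  simp only [G, Set.mem_iInter] at h1
  obtain ⟨x, hx⟩ := h1 i (Finset.mem_range.2 (by omega))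
  refine ⟨x, hx.trans (lt_of_le_of_lt ?_ hN)⟩
  gcongr
  exact le_max_right _ _

end Suprema

/-! ### The corner `A ⊗ e₀₀` of the stabilization -/

section Corner

variable {A : Type u} [CStarAlgebra A]

attribute [local instance] CStarAlgebra.spectralOrder CStarAlgebra.spectralOrderedRing

theorem MatN.norm_entry_le {n : ℕ} (x : MatN A n) (p q : Fin n) : ‖x.entry p q‖ ≤ ‖x‖ :=
  CStarMatrix.norm_entry_le_norm (M := (x : CStarMatrix (Fin n) (Fin n) A)) (i := p) (j := q)

theorem Stab.norm_single (i j : ℕ) (a : A) : ‖single i j a‖ = ‖a‖ := by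
  refine le_antisymm (norm_single_le i j a) (le_of_forall_gt_imp_ge_of_dense fun r hr => ?_)
  have h1 := RProd.eventually_lt (ω := atTop) (A := MatN A)
    (a := BProd.mk (fun n => MatN.single n i j a) ‖a‖ (fun n => MatN.norm_single_le n i j a)) hr
  obtain ⟨n, h1, hi, hj⟩ := (h1.and ((eventually_gt_atTop i).and (eventually_gt_atTop j))).exists
  refine le_trans ?_ h1.le
  have h2 := MatN.norm_entry_le (MatN.single n i j a) ⟨i, hi⟩ ⟨j, hj⟩
  have h3 : (MatN.single n i j a).entry ⟨i, hi⟩ ⟨j, hj⟩ = a := if_pos ⟨rfl, rfl⟩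
  rwa [h3] at h2

variable (A) in
/-- The embedding `a ↦ a ⊗ e₀₀` of `A` as a corner of `A ⊗ 𝒦`. -/
def corner : A →⋆ₙₐ[ℂ] Stab A where
  toFun := Stab.single 0 0
  map_smul' := Stab.single_smul 0 0
  map_zero' := Stab.single_zero 0 0
  map_add' := Stab.single_add 0 0
  map_mul' a b := by rw [Stab.single_mul_single, if_pos rfl]
  map_star' a := (Stab.star_single 0 0 a).symm

theorem norm_corner (a : A) : ‖corner A a‖ = ‖a‖ := Stab.norm_single 0 0 a

theorem isClosed_range_corner : IsClosed (Set.range (corner A)) :=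
  (AddMonoidHomClass.isometry_of_norm (corner A) norm_corner).isClosedEmbedding.isClosed_range

/-- The linear span of the `a ⊗ eᵢⱼ` is already closed under products and adjoints, hence dense, and
compressing it by `1 ⊗ e₀₀` keeps only the `(0, 0)` entries. The range of the corner embedding is
closed because the embedding is isometric. This is the way from witnesses in `A ⊗ 𝒦` back to
elements of `A`. -/
theorem exists_corner (z : Stab A) : ∃ a, corner A 1 * z * corner A 1 = corner A a := by
  have key : ∀ y ∈ NonUnitalStarAlgebra.adjoin ℂ
      {x : MatSeq A | ∃ (i j : ℕ) (a : A), x = tensorUnit i j a},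
      y ∈ Submodule.span ℂ {x : MatSeq A | ∃ (i j : ℕ) (a : A), x = tensorUnit i j a} := by
    intro y hy
    induction hy using NonUnitalStarAlgebra.adjoin_induction with
    | mem y hy => exact Submodule.subset_span hy
    | add y z _ _ hy hz => exact add_mem hy hz
    | zero => exact zero_mem _
    | smul r y _ hy => exact Submodule.smul_mem _ r hy
    | mul y z hy' hz' hy hz =>
      clear hy' hz'
      induction hy, hz using Submodule.span_induction₂ with
      | mem_mem y z hy hz =>
        obtain ⟨i, j, a, rfl⟩ := hy
        obtain ⟨k, l, b, rfl⟩ := hz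
        have h := congrArg Subtype.val (Stab.single_mul_single i j k l a b)
        change tensorUnit i j a * tensorUnit k l b = _ at h
        rw [h]
        split_ifs
        · exact Submodule.subset_span ⟨i, l, a * b, rfl⟩
        · exact zero_mem _
      | zero_left => simp
      | zero_right => simp
      | add_left _ _ _ _ _ _ h1 h2 => rw [add_mul]; exact add_mem h1 h2
      | add_right _ _ _ _ _ _ h1 h2 => rw [mul_add]; exact add_mem h1 h2
      | smul_left r _ _ _ _ h => rw [smul_mul_assoc]; exact Submodule.smul_mem _ r h
      | smul_right r _ _ _ _ h => rw [mul_smul_comm]; exact Submodule.smul_mem _ r h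
    | star y hy' hy =>
      clear hy'
      induction hy using Submodule.span_induction with
      | mem y hy =>
        obtain ⟨i, j, a, rfl⟩ := hy
        exact Submodule.subset_span ⟨j, i, star a, congrArg Subtype.val (Stab.star_single i j a)⟩
      | zero => simp
      | add _ _ _ _ h1 h2 => rw [star_add]; exact add_mem h1 h2
      | smul r _ _ h => rw [star_smul]; exact Submodule.smul_mem _ _ h
  have key2 : ∀ y ∈ Submodule.span ℂ {x : MatSeq A | ∃ (i j : ℕ) (a : A), x = tensorUnit i j a},
      ∃ a, (corner A 1).1 * y * (corner A 1).1 = (corner A a).1 := by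
    intro y hy
    induction hy using Submodule.span_induction with
    | mem y hy =>
      obtain ⟨i, j, a, rfl⟩ := hy
      have h : ∃ b, corner A 1 * Stab.single i j a * corner A 1 = corner A b := by
        change ∃ b, Stab.single 0 0 1 * Stab.single i j a * Stab.single 0 0 1 = Stab.single 0 0 b
        by_cases hi : 0 = i
        · by_cases hj : j = 0
          · exact ⟨a, by simp [Stab.single_mul_single, ← hi, hj]⟩
          · exact ⟨0, by simp [Stab.single_mul_single, ← hi, hj, Stab.single_zero]⟩
        · exact ⟨0, by simp [Stab.single_mul_single, hi, Stab.single_zero]⟩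
      obtain ⟨b, hb⟩ := h
      exact ⟨b, congrArg Subtype.val hb⟩
    | zero => exact ⟨0, by rw [mul_zero, zero_mul, map_zero]; rfl⟩
    | add y z _ _ h1 h2 =>
      obtain ⟨b, hb⟩ := h1
      obtain ⟨c, hc⟩ := h2
      exact ⟨b + c, by rw [mul_add, add_mul, hb, hc, map_add]; rfl⟩
    | smul r y _ h =>
      obtain ⟨b, hb⟩ := h
      exact ⟨r • b, by rw [mul_smul_comm, smul_mul_assoc, hb, map_smul]; rfl⟩
  have hcl : corner A 1 * z * corner A 1 ∈ closure (Set.range (corner A)) := by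
    have hz : z ∈ closure {w : Stab A | corner A 1 * w * corner A 1 ∈ Set.range (corner A)} := by
      rw [Metric.mem_closure_iff]
      intro ε hε
      obtain ⟨y, hy, hxy⟩ := Metric.mem_closure_iff.1 z.2 ε hε
      obtain ⟨a, ha⟩ := key2 y (key y hy)
      exact ⟨⟨y, NonUnitalStarSubalgebra.le_topologicalClosure _ hy⟩, ⟨a, (Subtype.ext ha).symm⟩, hxy⟩
    exact map_mem_closure (f := fun w => corner A 1 * w * corner A 1) (by fun_prop) hz fun _ h => h
  rw [isClosed_range_corner.closure_eq] at hcl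
  obtain ⟨a, ha⟩ := hcl
  exact ⟨a, ha.symm⟩

end Corner

/-! ### Compactness of the unit class -/

section UnitClass

variable {A : Type u} [CStarAlgebra A]

attribute [local instance] CStarAlgebra.spectralOrder CStarAlgebra.spectralOrderedRing

theorem norm_corner_one_le : ‖corner A 1‖ ≤ 1 := (norm_corner (1 : A)).trans_le (norm_one_le A)

theorem star_corner_one : star (corner A 1) = corner A 1 := by
  rw [← map_star, star_one]

theorem corner_one_mul_self : corner A 1 * corner A 1 = corner A 1 := by
  rw [← map_mul, one_mul]

theorem corner_injective : Function.Injective (corner A) :=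
  (AddMonoidHomClass.isometry_of_norm (corner A) norm_corner).injective

theorem norm_corner_conj_le (z : Stab A) : ‖corner A 1 * z * corner A 1‖ ≤ ‖z‖ := by
  have := Stab.norm_conj_le (x := z) (norm_corner_one_le (A := A))
  rwa [star_corner_one] at this

theorem unitClass_eq : unitClass A = Cu.mk ⟨corner A 1, corner A 1, by
    rw [star_corner_one, corner_one_mul_self]⟩ := rfl

/-- The unit is dominated by every positive element that can be conjugated close to it. -/
theorem cuntzLE_of_norm_sub_le (b : PosElt A) {z : Stab A}
    (h : ‖z * b.1 * star z - corner A 1‖ ≤ 1 / 2) : CuntzLE (corner A 1) b.1 := by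
  obtain ⟨r, hr⟩ := exists_corner (z * b.1 * star z)
  have hb : star b.1 = b.1 := by
    obtain ⟨_, c, rfl⟩ := b
    simp
  have hrs : IsSelfAdjoint r := by
    refine corner_injective ?_
    rw [map_star, ← hr]
    simp only [star_mul, star_star, star_corner_one, hb, mul_assoc]
  have hr1 : ‖r - 1‖ ≤ 1 / 2 := by
    rw [← norm_corner, map_sub, ← hr]
    refine le_trans (le_of_eq ?_) ((norm_corner_conj_le _).trans h)
    rw [mul_sub, sub_mul, corner_one_mul_self, corner_one_mul_self]
  intro ε hε
  obtain ⟨x, hx⟩ := exists_conj_one hrs hr1 hε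
  refine ⟨corner A x * corner A 1 * z, ?_⟩
  rw [← norm_corner, map_sub, map_mul, map_mul, ← hr, map_star] at hx
  refine lt_of_eq_of_lt ?_ hx
  simp only [star_mul, star_corner_one, mul_assoc]

/-- The class of the unit is compact. -/
theorem compactlyContained_unitClass : CompactlyContained (unitClass A) (unitClass A) := by
  intro w hw hlub
  choose a ha using fun n => (Cu.ind (p := fun x => ∃ a, Cu.mk a = x) fun a => ⟨a, rfl⟩) (w n)
  have hmono : ∀ n, CuntzLE (a n).1 (a (n + 1)).1 := fun n => by
    rw [← Cu.mk_le_mk, ha, ha]; exact hw n.le_succ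
  obtain ⟨s, b, has, hba, hbs⟩ := exists_upper_bound a hmono
  -- Any upper bound serves, since the supremum lies below it. One conjugate of `s` is within `1/2`
  -- of the unit; as `b n` converges to `s`, the same conjugator works for some `b n`, which lies
  -- below `a n`.
  have hs : unitClass A ≤ Cu.mk s := hlub.2 (by
    rintro _ ⟨n, rfl⟩
    rw [← ha]
    exact has n)
  rw [unitClass_eq, Cu.mk_le_mk] at hs
  obtain ⟨x, hx⟩ := hs (1 / 2) (by norm_num)
  have hlim : Tendsto (fun n => ‖x * (b n).1 * star x - corner A 1‖) atTop
      (𝓝 ‖x * s.1 * star x - corner A 1‖) :=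
    (((hbs.const_mul x).mul_const (star x)).sub_const _).norm
  obtain ⟨n, hn⟩ := (hlim.eventually (gt_mem_nhds hx)).exists
  refine ⟨n, ?_⟩
  rw [unitClass_eq, ← ha, Cu.mk_le_mk]
  exact (cuntzLE_of_norm_sub_le (b n) hn.le).trans (hba n)

end UnitClass

/-! ### Finite sums in the Cuntz semigroup in terms of elements -/

section Sums

variable {A : Type u} [CStarAlgebra A]

/-- Iterating the even/odd splitting of `ℕ` places the summands on disjoint copies of `ℕ`. The
injections are chosen before the summands, so one system of shifts serves every sum of length `m`.
-/
theorem exists_sum_eq (A : Type u) [CStarAlgebra A] (m : ℕ) :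
    ∃ f : Fin m → ℕ → ℕ, (∀ s, (f s).Injective) ∧
      (∀ s s', s ≠ s' → ∀ i j, f s i ≠ f s' j) ∧
      ∀ a : Fin m → PosElt A, ∃ c : PosElt A,
        c.1 = ∑ s, Stab.relabel (f s) (a s).1 ∧ ∑ s, Cu.mk (a s) = Cu.mk c := by
  induction m with
  | zero => exact ⟨fun s => s.elim0, fun s => s.elim0, fun s => s.elim0,
      fun a => ⟨⟨0, 0, by simp⟩, by simp, by simp [Cu.zero_def]⟩⟩
  | succ m ih =>
    obtain ⟨f, hf, hd, h⟩ := ih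
    refine ⟨Fin.cons ev fun s => od ∘ f s, ?_, ?_, fun a => ?_⟩
    · intro s
      refine Fin.cases ?_ (fun s => ?_) s
      · exact ev_injective
      · exact od_injective.comp (hf s)
    · intro s s'
      refine Fin.cases ?_ (fun s => ?_) s <;> refine Fin.cases ?_ (fun s' => ?_) s'
      · intro h; exact absurd rfl h
      · intro _ i j; exact ev_ne_od i _
      · intro _ i j; exact (ev_ne_od j _).symm
      · intro hs i j hij
        exact hd s s' (fun h => hs (congrArg Fin.succ h)) i j (od_injective hij)
    · obtain ⟨c, hc1, hc2⟩ := h fun s => a s.succ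
      refine ⟨(a 0).oplus c, ?_, ?_⟩
      · rw [Fin.sum_univ_succ]
        change Stab.relabel ev (a 0).1 + Stab.relabel od c.1 = Stab.relabel ev (a 0).1 +
          ∑ s : Fin m, Stab.relabel (od ∘ f s) (a s.succ).1
        rw [hc1]
        congr 1
        let φ : Stab A →+ Stab A := AddMonoidHom.mk' (Stab.relabel od)
          (Stab.relabel_add od_injective)
        refine (map_sum φ _ _).trans (Finset.sum_congr rfl fun s _ => ?_)
        exact Stab.relabel_comp od_injective (hf s) _
      · rw [Fin.sum_univ_succ, hc2, Cu.mk_add_mk]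

variable {m : ℕ} {f : Fin m → ℕ → ℕ}

/-- The shifts read off the block matrix entries of an orthogonal sum: the off-diagonal blocks
vanish and the diagonal ones are compressions of the summands. -/
theorem star_shift_mul_sum_relabel (hf : ∀ s, (f s).Injective)
    (hd : ∀ s s', s ≠ s' → ∀ i j, f s i ≠ f s' j) (a : Fin m → Stab A) (M : ℕ) (s s' : Fin m) :
    star (Stab.shift A (f s) M) * (∑ k, Stab.relabel (f k) (a k)) * Stab.shift A (f s') M =
      if s = s' then Stab.shift A id M * a s * Stab.shift A id M else 0 := by
  rw [Finset.mul_sum, Finset.sum_eq_single s]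
  · split_ifs with h
    · subst h
      exact Stab.star_shift_mul_relabel (hf s) M (a s)
    · have h1 := Stab.star_shift_mul_relabel_of_disjoint (hf s)
        (fun i j => hd s' s (Ne.symm h) i j) M (star (a s))
      rw [Stab.relabel_star (hf s), ← star_mul] at h1
      rw [mul_assoc, star_eq_zero.1 h1, mul_zero]
  · intro k _ hk
    exact Stab.star_shift_mul_relabel_of_disjoint (hf k) (fun i j => hd s k hk.symm i j) M _
  · simp

theorem tendsto_sum_shift (hf : ∀ s, (f s).Injective) (a : Fin m → Stab A) :
    Tendsto (fun M => ∑ k, Stab.shift A (f k) M * a k * star (Stab.shift A (f k) M)) atTop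
      (𝓝 (∑ k, Stab.relabel (f k) (a k))) :=
  tendsto_finsetSum _ fun k _ => Stab.tendsto_relabel (hf k) (a k)

theorem norm_mul_mul_le_of_le_one {u v x : Stab A} (hu : ‖u‖ ≤ 1) (hv : ‖v‖ ≤ 1) :
    ‖u * x * v‖ ≤ ‖x‖ := by
  have h1 := norm_mul_le (u * x) v
  have h2 := norm_mul_le u x
  have h3 : ‖u‖ * ‖x‖ ≤ ‖x‖ := mul_le_of_le_one_left (norm_nonneg _) hu
  have h4 : ‖u * x‖ * ‖v‖ ≤ ‖u * x‖ := mul_le_of_le_one_right (norm_nonneg _) hv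
  linarith

/-- A sum of classes is dominated by `⟨b⟩` if and only if its terms are approximated by mutually
orthogonal conjugates of `b`. -/
theorem sum_mk_le_iff (a : Fin m → PosElt A) (b : PosElt A) :
    ∑ s, Cu.mk (a s) ≤ Cu.mk b ↔ ∀ ε : ℝ, 0 < ε → ∃ x : Fin m → Stab A,
      ∀ s s', ‖x s * b.1 * star (x s') - if s = s' then (a s).1 else 0‖ < ε := by
  obtain ⟨f, hf, hd, h⟩ := exists_sum_eq A m
  obtain ⟨c, hc, hsum⟩ := h a
  rw [hsum, Cu.mk_le_mk, hc]
  constructor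
  · intro hle ε hε
    obtain ⟨X, hX⟩ := hle (ε / 2) (half_pos hε)
    have hev : ∀ᶠ M in atTop, ∀ s,
        ‖Stab.shift A id M * (a s).1 * Stab.shift A id M - (a s).1‖ < ε / 2 := by
      rw [eventually_all]
      intro s
      filter_upwards [Metric.tendsto_nhds.1 (Stab.tendsto_conj_proj (a s).1) (ε / 2)
        (half_pos hε)] with M hM
      rwa [dist_eq_norm] at hM
    obtain ⟨M, hM⟩ := hev.exists
    -- These are the block rows of `X` along the copies of `ℕ`; conversely, such rows are stacked
    -- again by the shifts.
    refine ⟨fun s => star (Stab.shift A (f s) M) * X, fun s s' => ?_⟩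
    have h1 : star (Stab.shift A (f s) M) * X * b.1 * star (star (Stab.shift A (f s') M) * X) -
        (if s = s' then (a s).1 else 0) =
        star (Stab.shift A (f s) M) * (X * b.1 * star X - ∑ k, Stab.relabel (f k) (a k).1) *
          Stab.shift A (f s') M +
        (if s = s' then Stab.shift A id M * (a s).1 * Stab.shift A id M - (a s).1 else 0) := by
      rw [mul_sub, sub_mul, star_shift_mul_sum_relabel hf hd (fun k => (a k).1)]
      rw [star_mul, star_star]
      simp only [mul_assoc]
      split_ifs <;> abel
    rw [h1]
    refine (norm_add_le _ _).trans_lt ?_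
    have h2 := norm_mul_mul_le_of_le_one
      (x := X * b.1 * star X - ∑ k, Stab.relabel (f k) (a k).1)
      ((norm_star (Stab.shift A (f s) M)).trans_le (Stab.norm_shift_le (hf s) M))
      (Stab.norm_shift_le (hf s') M)
    have h3 : ‖if s = s' then Stab.shift A id M * (a s).1 * Stab.shift A id M - (a s).1 else 0‖
        < ε / 2 := by
      split_ifs
      · exact hM s
      · rw [norm_zero]; exact half_pos hε
    linarith
  · intro h ε hε
    -- The total error is a sum over the `m * m` blocks; the summand `1` keeps the denominator
    -- positive when `m = 0`.
    obtain ⟨x, hx⟩ := h (ε / 2 / (m * m + 1)) (by positivity)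
    obtain ⟨M, hM⟩ := (Metric.tendsto_nhds.1 (tendsto_sum_shift hf fun k => (a k).1) (ε / 2)
      (half_pos hε)).exists
    rw [dist_eq_norm] at hM
    refine ⟨∑ s, Stab.shift A (f s) M * x s, ?_⟩
    have h1 : (∑ s, Stab.shift A (f s) M * x s) * b.1 * star (∑ s, Stab.shift A (f s) M * x s) -
        ∑ k, Stab.relabel (f k) (a k).1 =
        (∑ s, ∑ s', Stab.shift A (f s) M * (x s * b.1 * star (x s') -
          if s = s' then (a s).1 else 0) * star (Stab.shift A (f s') M)) +
        (∑ k, Stab.shift A (f k) M * (a k).1 * star (Stab.shift A (f k) M) -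
          ∑ k, Stab.relabel (f k) (a k).1) := by
      rw [star_sum, Finset.sum_mul, Finset.sum_mul_sum]
      simp only [mul_sub, sub_mul, Finset.sum_sub_distrib, mul_ite, ite_mul, mul_zero, zero_mul,
        Finset.sum_ite_eq, Finset.mem_univ, if_true, star_mul, mul_assoc]
      abel
    rw [h1]
    refine (norm_add_le _ _).trans_lt ?_
    have h2 : ‖∑ s, ∑ s', Stab.shift A (f s) M * (x s * b.1 * star (x s') -
          if s = s' then (a s).1 else 0) * star (Stab.shift A (f s') M)‖ ≤
        ∑ _s : Fin m, ∑ _s' : Fin m, ε / 2 / (m * m + 1) := by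
      refine (norm_sum_le _ _).trans (Finset.sum_le_sum fun s _ => (norm_sum_le _ _).trans
        (Finset.sum_le_sum fun s' _ => ?_))
      exact (norm_mul_mul_le_of_le_one (Stab.norm_shift_le (hf s) M)
        ((norm_star (Stab.shift A (f s') M)).trans_le (Stab.norm_shift_le (hf s') M))).trans
          (hx s s').le
    have h3 : ∑ _s : Fin m, ∑ _s' : Fin m, ε / 2 / ((m : ℝ) * m + 1) ≤ ε / 2 := by
      simp only [Finset.sum_const, Finset.card_univ, Fintype.card_fin, nsmul_eq_mul]
      rw [← mul_assoc, mul_div_assoc', div_le_iff₀ (by positivity)]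
      nlinarith
    linarith

/-- A class `⟨b⟩` is dominated by a sum of classes if and only if `b` is approximated by sums of
conjugates of the terms. -/
theorem le_sum_mk_iff (a : Fin m → PosElt A) (b : PosElt A) :
    Cu.mk b ≤ ∑ s, Cu.mk (a s) ↔ ∀ ε : ℝ, 0 < ε → ∃ d : Fin m → Stab A,
      ‖∑ s, d s * (a s).1 * star (d s) - b.1‖ < ε := by
  obtain ⟨f, hf, hd, h⟩ := exists_sum_eq A m
  obtain ⟨c, hc, hsum⟩ := h a
  rw [hsum, Cu.mk_le_mk, hc]
  constructor
  · intro hle ε hε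
    obtain ⟨X, hX⟩ := hle ε hε
    have hlim := ((((tendsto_sum_shift hf fun k => (a k).1).const_mul X).mul_const
      (star X)).sub_const b.1).norm
    obtain ⟨M, hM⟩ := (hlim.eventually (gt_mem_nhds hX)).exists
    refine ⟨fun s => X * Stab.shift A (f s) M, lt_of_eq_of_lt ?_ hM⟩
    simp only [Finset.mul_sum, Finset.sum_mul, star_mul, mul_assoc]
  · intro h ε hε
    obtain ⟨d, hd'⟩ := h ε hε
    have hlim : Tendsto (fun M => ‖∑ s, d s * (Stab.shift A id M * (a s).1 * Stab.shift A id M) *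
        star (d s) - b.1‖) atTop (𝓝 ‖∑ s, d s * (a s).1 * star (d s) - b.1‖) :=
      ((tendsto_finsetSum _ fun s _ =>
        ((Stab.tendsto_conj_proj (a s).1).const_mul (d s)).mul_const _).sub_const _).norm
    obtain ⟨M, hM⟩ := (hlim.eventually (gt_mem_nhds hd')).exists
    -- The `d s` are put side by side into one row; orthogonality of the blocks kills all cross
    -- terms of the conjugation.
    refine ⟨∑ s, d s * star (Stab.shift A (f s) M), lt_of_eq_of_lt ?_ hM⟩
    congr 2
    rw [star_sum, Finset.sum_mul, Finset.sum_mul_sum]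
    refine Finset.sum_congr rfl fun s _ => ?_
    have h1 : ∀ s', d s * star (Stab.shift A (f s) M) * (∑ k, Stab.relabel (f k) (a k).1) *
        star (d s' * star (Stab.shift A (f s') M)) = if s = s' then
          d s * (Stab.shift A id M * (a s).1 * Stab.shift A id M) * star (d s) else 0 := by
      intro s'
      have h2 := star_shift_mul_sum_relabel hf hd (fun k => (a k).1) M s s'
      rw [star_mul, star_star]
      calc _ = d s * (star (Stab.shift A (f s) M) * (∑ k, Stab.relabel (f k) (a k).1) *
            Stab.shift A (f s') M) * star (d s') := by simp only [mul_assoc]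
        _ = _ := by
          rw [h2]
          split_ifs with hs
          · rw [hs]
          · rw [mul_zero, zero_mul]
    simp only [h1, Finset.sum_ite_eq, Finset.mem_univ, if_true]

end Sums

/-! ### Finite systems of inequalities against the unit -/

/-- A finite system of inequalities `∑ₛ x_{φ(p,s)} ≤ ⟨1⟩` and `⟨1⟩ ≤ ∑ₜ x_{ψ(q,t)}` is solvable in
`Cu(A)`. -/
def Solvable (A : Type u) [CStarAlgebra A] {J P Q : Type} {m n : ℕ} (φ : P → Fin m → J)
    (ψ : Q → Fin n → J) : Prop :=
  ∃ x : J → Cu A, (∀ p, ∑ s, x (φ p s) ≤ unitClass A) ∧ ∀ q, unitClass A ≤ ∑ t, x (ψ q t)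

/-- The system of inequalities of `Solvable` is witnessed, up to the error `ε`, by elements of `A`
of norm at most `K`. -/
def ApproxSolvable (A : Type u) [CStarAlgebra A] {J P Q : Type} {m n : ℕ} (φ : P → Fin m → J)
    (ψ : Q → Fin n → J) (ε K : ℝ) : Prop :=
  ∃ (c : J → A) (h : P → Fin m → A) (w : Q → Fin n → A),
    (∀ j, ‖c j‖ ≤ K) ∧ (∀ p s, ‖h p s‖ ≤ K) ∧ (∀ q t, ‖w q t‖ ≤ K) ∧
    (∀ p s s', ‖h p s * star (h p s') -
      if s = s' then c (φ p s) * star (c (φ p s)) else 0‖ ≤ ε) ∧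
    ∀ q, ‖∑ t, w q t * (c (ψ q t) * star (c (ψ q t))) * star (w q t) - 1‖ ≤ ε

/-! ### From solutions to approximate witnesses of uniformly bounded norm -/

section Witnesses

attribute [local instance] CStarAlgebra.spectralOrder CStarAlgebra.spectralOrderedRing

variable {A : Type u} [CStarAlgebra A]

/-- `c` is a continuous substitute for the support projection of `G`: the function `t² / max(t²,
r²)` equals `1` where `|t| ≥ r`. It factors as `k G` with `k` a truncated inverse of `G`, whose norm
is controlled by `r`. -/
theorem exists_cutoff {G : A} (hG : IsSelfAdjoint G) {r : ℝ} (hr : 0 < r) :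
    ∃ k c : A, IsSelfAdjoint k ∧ IsSelfAdjoint c ∧ c = k * G ∧ c = G * k ∧ ‖c‖ ≤ 1 ∧ ‖k‖ ≤ 1 / r ∧
      ‖(1 - c) * G * (1 - c)‖ ≤ r := by
  have hpos : ∀ t : ℝ, 0 < max (t ^ 2) (r ^ 2) := fun t => lt_max_of_lt_right (by positivity)
  have hk : Continuous fun t : ℝ => t / max (t ^ 2) (r ^ 2) :=
    Continuous.div (by fun_prop) (by fun_prop) fun t => (hpos t).ne'
  have hc : Continuous fun t : ℝ => t / max (t ^ 2) (r ^ 2) * t := by fun_prop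
  have hbound : ∀ t : ℝ, 0 ≤ t / max (t ^ 2) (r ^ 2) * t ∧ t / max (t ^ 2) (r ^ 2) * t ≤ 1 := by
    intro t
    have : t / max (t ^ 2) (r ^ 2) * t = t ^ 2 / max (t ^ 2) (r ^ 2) := by ring
    rw [this]
    exact ⟨div_nonneg (sq_nonneg t) (hpos t).le, (div_le_one (hpos t)).2 (le_max_left _ _)⟩
  have hcG : cfc (fun t : ℝ => t / max (t ^ 2) (r ^ 2) * t) G =
      cfc (fun t : ℝ => t / max (t ^ 2) (r ^ 2)) G * G := by
    rw [cfc_mul _ (fun t : ℝ => t) G hk.continuousOn (by fun_prop), cfc_id' ℝ G]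
  refine ⟨cfc (fun t : ℝ => t / max (t ^ 2) (r ^ 2)) G,
    cfc (fun t : ℝ => t / max (t ^ 2) (r ^ 2) * t) G, cfc_predicate _ _, cfc_predicate _ _,
    hcG, ?_, ?_, ?_, ?_⟩
  · rw [hcG]
    exact ((Commute.refl G).cfc_real (f := fun t : ℝ => t / max (t ^ 2) (r ^ 2))).eq
  · refine norm_cfc_le zero_le_one fun t _ => ?_
    rw [Real.norm_eq_abs, abs_of_nonneg (hbound t).1]
    exact (hbound t).2
  · refine norm_cfc_le (by positivity) fun t _ => ?_
    rw [Real.norm_eq_abs, abs_div, abs_of_pos (hpos t), div_le_div_iff₀ (hpos t) hr, one_mul]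
    rcases le_total |t| r with h | h
    · exact le_trans (by nlinarith [abs_nonneg t]) (le_max_right _ _)
    · exact le_trans (by nlinarith [abs_nonneg t, sq_abs t]) (le_max_left _ _)
  · have h1 : (1 : A) - cfc (fun t : ℝ => t / max (t ^ 2) (r ^ 2) * t) G =
        cfc (fun t : ℝ => 1 - t / max (t ^ 2) (r ^ 2) * t) G := by
      rw [cfc_sub (fun _ : ℝ => (1 : ℝ)) _ G (by fun_prop) hc.continuousOn, cfc_const_one ℝ G]
    have h2 : cfc (fun t : ℝ => 1 - t / max (t ^ 2) (r ^ 2) * t) G * G *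
        cfc (fun t : ℝ => 1 - t / max (t ^ 2) (r ^ 2) * t) G =
        cfc (fun t : ℝ => (1 - t / max (t ^ 2) (r ^ 2) * t) * t *
          (1 - t / max (t ^ 2) (r ^ 2) * t)) G := by
      have h3 : ContinuousOn (fun t : ℝ => 1 - t / max (t ^ 2) (r ^ 2) * t) (spectrum ℝ G) :=
        (continuous_const.sub hc).continuousOn
      rw [cfc_mul (fun t : ℝ => (1 - t / max (t ^ 2) (r ^ 2) * t) * t) _ G (by fun_prop) h3,
        cfc_mul _ (fun t : ℝ => t) G h3 (by fun_prop), cfc_id' ℝ G]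
    rw [h1, h2]
    refine norm_cfc_le hr.le fun t _ => ?_
    obtain ⟨h4, h5⟩ := hbound t
    rcases le_total |t| r with h | h
    · rw [Real.norm_eq_abs, abs_mul, abs_mul, abs_of_nonneg (sub_nonneg.2 h5)]
      have h6 : (1 - t / max (t ^ 2) (r ^ 2) * t) * |t| ≤ |t| :=
        mul_le_of_le_one_left (abs_nonneg t) (by linarith)
      exact (mul_le_of_le_one_right (mul_nonneg (by linarith) (abs_nonneg t)) (by linarith)).trans
        (h6.trans h)
    · have h6 : r ^ 2 ≤ t ^ 2 := by rw [← sq_abs t]; gcongr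
      have h7 : t ≠ 0 := by
        rintro rfl
        rw [abs_zero] at h
        exact absurd hr (not_lt.2 h)
      have h8 : t / max (t ^ 2) (r ^ 2) * t = 1 := by
        rw [max_eq_left h6]
        field_simp
      rw [h8]
      simpa using hr.le

theorem norm_le_of_sum_mul_star {n : ℕ} (w : Fin n → A) {C : ℝ} (hC : 0 ≤ C)
    (h : ‖∑ t, w t * star (w t)‖ ≤ C ^ 2) (t : Fin n) : ‖w t‖ ≤ C := by
  have h1 : w t * star (w t) ≤ ∑ t, w t * star (w t) :=
    Finset.single_le_sum (f := fun t => w t * star (w t)) (fun t _ => mul_star_self_nonneg (w t))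
      (Finset.mem_univ t)
  have h2 := (CStarAlgebra.norm_le_norm_of_nonneg_of_le (mul_star_self_nonneg (w t)) h1).trans h
  rw [CStarRing.norm_self_mul_star] at h2
  exact abs_le_of_sq_le_sq' (by nlinarith) hC |>.2

theorem norm_conj_le_of_le {M : Type u} [NonUnitalCStarAlgebra M] {u x : M} {D η : ℝ}
    (hD : ‖u‖ ≤ D) (hx : ‖x‖ ≤ η) : ‖u * x * star u‖ ≤ D * η * D := by
  have h0 : 0 ≤ D := (norm_nonneg _).trans hD
  refine (norm_mul_le _ _).trans ?_
  rw [norm_star]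
  exact mul_le_mul ((norm_mul_le _ _).trans (mul_le_mul hD hx (norm_nonneg _) h0)) hD
    (norm_nonneg _) (mul_nonneg h0 ((norm_nonneg _).trans hx))

/-- By the C⋆-identity `‖y (1 - c)‖² = ‖(1 - c) G (1 - c)‖`, so `y` nearly absorbs `c`; the
difference factors as `y (1 - c) (1 + c) y⋆`. -/
theorem norm_mul_cutoff_le {y : Stab A} {G c : A} (hc : IsSelfAdjoint c)
    (hyG : star y * y = corner A G) (hyp : y * corner A 1 = y) {r L : ℝ} (hr : 0 ≤ r)
    (hyL : ‖y‖ ≤ L) (hc1 : ‖c‖ ≤ 1) (hcut : ‖(1 - c) * G * (1 - c)‖ ≤ r ^ 2) :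
    ‖y * star y - y * corner A (c * star c) * star y‖ ≤ r * 2 * L := by
  have h1 : ‖y * corner A (1 - c)‖ ≤ r := by
    have h2 : ‖y * corner A (1 - c)‖ * ‖y * corner A (1 - c)‖ ≤ r ^ 2 := by
      rw [← CStarRing.norm_star_mul_self, star_mul, ← map_star, star_sub, star_one, hc.star_eq]
      refine le_trans (le_of_eq ?_) hcut
      rw [← norm_corner, map_mul, map_mul, ← hyG]
      simp only [mul_assoc]
    exact abs_le_of_sq_le_sq' (by nlinarith) hr |>.2
  have h3 : ‖corner A (1 + c)‖ ≤ 2 := by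
    rw [norm_corner]
    linarith [norm_add_le 1 c, norm_one_le A]
  have h4 : y * star y - y * corner A (c * star c) * star y =
      y * corner A (1 - c) * corner A (1 + c) * star y := by
    have h5 : c * star c = 1 - (1 - c) * (1 + c) := by
      rw [hc.star_eq]; noncomm_ring
    rw [h5, map_sub, mul_sub, hyp, map_mul, sub_mul]
    simp only [mul_assoc]
    abel
  have hL : 0 ≤ L := (norm_nonneg _).trans hyL
  rw [h4]
  refine (norm_mul_le _ _).trans ?_
  rw [norm_star]
  refine mul_le_mul ((norm_mul_le _ _).trans (mul_le_mul h1 h3 (norm_nonneg _) hr)) hyL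
    (norm_nonneg _) (by positivity)

variable {J P Q : Type} [Fintype J] [Fintype Q] {m n : ℕ} {φ : P → Fin m → J}
  {ψ : Q → Fin n → J}

/-- Every unknown occurs in some upper inequality, so its representative satisfies `a j ≈ y y⋆` with
`y` supported on the right by `1 ⊗ e₀₀`. Then `y⋆ y` is an element `G` of `A`, and the positive
element `a j` is replaced by `c c⋆`, where `c` is the cutoff of `G`. The original witnesses `z`, `d`
are carried along as `h = k y⋆ z` and `w = d y`, compressed to the corner. Their own norms may be
arbitrarily large, but the new ones satisfy `h h⋆ ≈ c c⋆` and `∑ w w⋆ ≈ 1`, and this alone bounds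
them by 2. -/
theorem Solvable.approxSolvable (hφ : ∀ j, ∃ p s, φ p s = j) (hsol : Solvable A φ ψ) {ε : ℝ}
    (hε : 0 < ε) (hε1 : ε ≤ 1) : ApproxSolvable A φ ψ ε 2 := by
  obtain ⟨x, hup, hlow⟩ := hsol
  choose a ha using fun j => (Cu.ind (p := fun x => ∃ a, Cu.mk a = x) fun a => ⟨a, rfl⟩) (x j)
  obtain rfl : (fun j => Cu.mk (a j)) = x := funext ha
  choose p₀ s₀ hps using hφ
  -- the witnesses of the lower estimates and the bounds on which the further choices depend
  have hlow' : ∀ q, ∃ d : Fin n → Stab A,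
      ‖∑ t, d t * (a (ψ q t)).1 * star (d t) - corner A 1‖ < ε / 3 := fun q =>
    (le_sum_mk_iff (fun t => a (ψ q t)) _).1 (hlow q) (ε / 3) (by positivity)
  choose d hd using hlow'
  obtain ⟨D, hD1, hD⟩ : ∃ D : ℝ, 1 ≤ D ∧ ∀ q t, ‖d q t‖ ≤ D := by
    refine ⟨1 + ∑ q, ∑ t, ‖d q t‖, le_add_of_nonneg_right (by positivity), fun q t => ?_⟩
    have h1 : ‖d q t‖ ≤ ∑ t, ‖d q t‖ :=
      Finset.single_le_sum (f := fun t => ‖d q t‖) (fun _ _ => norm_nonneg _) (Finset.mem_univ t)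
    have h2 : ∑ t, ‖d q t‖ ≤ ∑ q, ∑ t, ‖d q t‖ :=
      Finset.single_le_sum (f := fun q => ∑ t, ‖d q t‖) (fun _ _ => by positivity)
        (Finset.mem_univ q)
    linarith
  obtain ⟨L, hL1, hL⟩ : ∃ L : ℝ, 1 ≤ L ∧ ∀ j, ‖(a j).1‖ + 1 ≤ L := by
    refine ⟨1 + ∑ j, ‖(a j).1‖, le_add_of_nonneg_right (by positivity), fun j => ?_⟩
    have := Finset.single_le_sum (f := fun j => ‖(a j).1‖) (fun _ _ => norm_nonneg _)
      (Finset.mem_univ j)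
    linarith
  -- The order of choices matters: `r` depends on the lower witnesses through `D` and on `L`, and
  -- `η` depends on `r`, because the truncated inverse `k` has norm up to `1 / r ^ 2`. The upper
  -- witnesses `z` come last; no bound on them is needed.
  obtain ⟨r, hr0, hr⟩ : ∃ r : ℝ, 0 < r ∧ n * (D * (r * 2 * L) * D) ≤ ε / 3 := by
    refine ⟨ε / (6 * (n + 1) * D ^ 2 * L), by positivity, ?_⟩
    rw [show (n : ℝ) * (D * (ε / (6 * (n + 1) * D ^ 2 * L) * 2 * L) * D) = ε / 3 * (n / (n + 1)) by
      field_simp; ring]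
    exact mul_le_of_le_one_right (by positivity) ((div_le_one (by positivity)).2 (by linarith))
  obtain ⟨η, hη0, hη1, hηn, hηr⟩ : ∃ η : ℝ, 0 < η ∧ η ≤ 1 ∧ n * (D * η * D) ≤ ε / 3 ∧
      1 / r ^ 2 * (2 * (L * η * L)) * (1 / r ^ 2) ≤ ε := by
    refine ⟨min 1 (min (ε / 3 / (n * D * D + 1)) (ε / (2 * L * L / r ^ 4 + 1))), by positivity,
      min_le_left _ _, ?_, ?_⟩
    · have h1 := (min_le_right (1 : ℝ) _).trans (min_le_left (ε / 3 / (n * D * D + 1))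
        (ε / (2 * L * L / r ^ 4 + 1)))
      rw [le_div_iff₀ (by positivity)] at h1
      have h2 : 0 < min 1 (min (ε / 3 / (n * D * D + 1)) (ε / (2 * L * L / r ^ 4 + 1))) := by
        positivity
      linarith
    · have h1 := (min_le_right (1 : ℝ) _).trans (min_le_right (ε / 3 / (n * D * D + 1))
        (ε / (2 * L * L / r ^ 4 + 1)))
      rw [le_div_iff₀ (by positivity)] at h1
      have h2 : 0 < min 1 (min (ε / 3 / (n * D * D + 1)) (ε / (2 * L * L / r ^ 4 + 1))) := by
        positivity
      refine le_trans ?_ h1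
      rw [mul_add, mul_one]
      refine le_trans (le_of_eq ?_) (le_add_of_nonneg_right h2.le)
      field_simp
  have hup' : ∀ p, ∃ x : Fin m → Stab A, ∀ s s', ‖x s * corner A 1 * star (x s') -
      if s = s' then (a (φ p s)).1 else 0‖ < η := fun p =>
    (sum_mk_le_iff (fun s => a (φ p s)) _).1 (hup p) η hη0
  choose z hz using hup'
  -- the elements `y j` with `y j * star (y j) ≈ a j`, and the elements of `A` built from them
  let y : J → Stab A := fun j => z (p₀ j) (s₀ j) * corner A 1
  have hyp : ∀ j, y j * corner A 1 = y j := fun j => by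
    simp only [y, mul_assoc, corner_one_mul_self]
  have hys : ∀ j, star (y j) = corner A 1 * star (z (p₀ j) (s₀ j)) := fun j => by
    simp only [y, star_mul, star_corner_one]
  have hzz : ∀ u v : Stab A, u * corner A 1 * (corner A 1 * v) = u * corner A 1 * v := by
    intro u v
    rw [mul_assoc u, ← mul_assoc (corner A 1), corner_one_mul_self, ← mul_assoc]
  have hya : ∀ j, ‖y j * star (y j) - (a j).1‖ ≤ η := by
    intro j
    have h1 := (hz (p₀ j) (s₀ j) (s₀ j)).le
    rw [if_pos rfl, hps] at h1
    rw [hys, hzz]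
    exact h1
  have hyL2 : ∀ j, ‖y j‖ * ‖y j‖ ≤ L := by
    intro j
    rw [← CStarRing.norm_self_mul_star]
    have h1 := norm_le_norm_add_norm_sub' (y j * star (y j)) (a j).1
    linarith [hya j, hL j]
  have hyL : ∀ j, ‖y j‖ ≤ L := fun j =>
    abs_le_of_sq_le_sq' (by nlinarith [hyL2 j]) (by linarith) |>.2
  choose G hG using fun j => exists_corner (star (z (p₀ j) (s₀ j)) * z (p₀ j) (s₀ j))
  have hyG : ∀ j, star (y j) * y j = corner A (G j) := fun j => by
    rw [← hG, hys]; simp only [y, mul_assoc]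
  have hGs : ∀ j, IsSelfAdjoint (G j) := fun j => by
    refine corner_injective ?_
    rw [map_star, ← hyG, star_mul, star_star]
  -- Cut off at `r ^ 2`, so that `‖y (1 - c)‖ ≤ r` after taking the square root.
  choose k c hks hcs hck hck' hc1 hk hcut using fun j => exists_cutoff (hGs j) (pow_pos hr0 2)
  choose H hH using fun p s => exists_corner (star (z (p₀ (φ p s)) (s₀ (φ p s))) * z p s)
  have hyH : ∀ p s, star (y (φ p s)) * (z p s * corner A 1) = corner A (H p s) := fun p s => by
    rw [← hH, hys]; simp only [mul_assoc]
  choose W hW using fun q t => exists_corner (d q t * z (p₀ (ψ q t)) (s₀ (ψ q t)))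
  have hyW : ∀ q t, corner A 1 * d q t * y (ψ q t) = corner A (W q t) := fun q t => by
    rw [← hW]; simp only [y, mul_assoc]
  -- `H H⋆ = y⋆ (z 1 z⋆) y`, where `1` is the corner unit. For `s = s'` the middle factor is close
  -- to `a ≈ y y⋆`, which gives `y⋆ y y⋆ y = G²`; otherwise it is close to `0`. Multiplying by `k`
  -- on both sides then turns `G²` into `c²`.
  have hHH : ∀ p s s', ‖H p s * star (H p s') -
      if s = s' then G (φ p s) * G (φ p s) else 0‖ ≤ 2 * (L * η * L) := by
    intro p s s'
    have h1 : ∀ (j : J) (v : Stab A), ‖v‖ ≤ η → ∀ i, ‖star (y j) * v * y i‖ ≤ L * η * L := by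
      intro j v hv i
      refine (norm_mul_le _ _).trans (mul_le_mul ((norm_mul_le _ _).trans ?_) (hyL i)
        (norm_nonneg _) (by positivity))
      rw [norm_star]
      exact mul_le_mul (hyL j) hv (norm_nonneg _) (by positivity)
    have h2 : 0 ≤ L * η * L := by positivity
    have h3 : corner A (H p s * star (H p s')) =
        star (y (φ p s)) * (z p s * corner A 1 * star (z p s')) * y (φ p s') := by
      rw [map_mul, map_star, ← hyH, ← hyH]
      simp only [star_mul, star_star, star_corner_one]
      rw [← hzz (z p s) (star (z p s'))]
      simp only [mul_assoc]
    rw [← norm_corner, map_sub, h3]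
    have h4 := h1 (φ p s) _ (hz p s s').le (φ p s')
    split_ifs with hs
    · subst hs
      rw [if_pos rfl] at h4
      have h5 := h1 (φ p s) _ (hya (φ p s)) (φ p s)
      rw [map_mul, ← hyG]
      have h6 : star (y (φ p s)) * (z p s * corner A 1 * star (z p s)) * y (φ p s) -
          star (y (φ p s)) * y (φ p s) * (star (y (φ p s)) * y (φ p s)) =
          star (y (φ p s)) * (z p s * corner A 1 * star (z p s) - (a (φ p s)).1) * y (φ p s) -
          star (y (φ p s)) * (y (φ p s) * star (y (φ p s)) - (a (φ p s)).1) * y (φ p s) := by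
        simp only [mul_sub, sub_mul, mul_assoc]
        abel
      rw [h6]
      linarith [norm_sub_le
        (star (y (φ p s)) * (z p s * corner A 1 * star (z p s) - (a (φ p s)).1) * y (φ p s))
        (star (y (φ p s)) * (y (φ p s) * star (y (φ p s)) - (a (φ p s)).1) * y (φ p s))]
    · rw [if_neg hs] at h4
      rw [map_zero, sub_zero]
      rw [sub_zero] at h4
      linarith
  have hhh : ∀ p s s', ‖k (φ p s) * H p s * star (k (φ p s') * H p s') -
      if s = s' then c (φ p s) * star (c (φ p s)) else 0‖ ≤ ε := by
    intro p s s'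
    have h1 : k (φ p s) * H p s * star (k (φ p s') * H p s') -
        (if s = s' then c (φ p s) * star (c (φ p s)) else 0) =
        k (φ p s) * (H p s * star (H p s') - if s = s' then G (φ p s) * G (φ p s) else 0) *
          k (φ p s') := by
      rw [star_mul, (hks _).star_eq]
      split_ifs with hs
      · subst hs
        rw [(hcs _).star_eq]
        nth_rewrite 2 [hck']
        rw [hck]
        simp only [mul_sub, sub_mul, mul_assoc]
      · simp only [sub_zero, mul_assoc]
    rw [h1]
    refine le_trans ?_ hηr
    refine (norm_mul_le _ _).trans (mul_le_mul ((norm_mul_le _ _).trans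
      (mul_le_mul (hk _) (hHH p s s') (norm_nonneg _) (by positivity))) (hk _) (norm_nonneg _)
      (by positivity))
  have hWW : ∀ q, ‖∑ t, W q t * star (W q t) - 1‖ ≤ ε / 3 + ε / 3 := by
    intro q
    have h1 : corner A (∑ t, W q t * star (W q t) - 1) =
        corner A 1 * (∑ t, d q t * (a (ψ q t)).1 * star (d q t) - corner A 1) * corner A 1 +
        corner A 1 * (∑ t, d q t * (y (ψ q t) * star (y (ψ q t)) - (a (ψ q t)).1) * star (d q t)) *
          corner A 1 := by
      rw [← add_mul, ← mul_add, sub_add_eq_add_sub, ← Finset.sum_add_distrib, map_sub, map_sum,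
        mul_sub, sub_mul, corner_one_mul_self, corner_one_mul_self, Finset.mul_sum, Finset.sum_mul]
      congr 1
      refine Finset.sum_congr rfl fun t _ => ?_
      rw [map_mul, map_star, ← hyW]
      simp only [star_mul, star_corner_one, mul_sub, sub_mul, mul_assoc]
      rw [add_sub_cancel]
      simp only [mul_assoc]
    rw [← norm_corner, h1]
    refine (norm_add_le _ _).trans (add_le_add ((norm_corner_conj_le _).trans (hd q).le)
      ((norm_corner_conj_le _).trans ?_))
    refine (norm_sum_le _ _).trans ((Finset.sum_le_sum (g := fun _ => D * η * D) fun t _ =>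
      norm_conj_le_of_le (hD q t) (hya _)).trans ?_)
    simpa using hηn
  refine ⟨c, fun p s => k (φ p s) * H p s, W, fun j => (hc1 j).trans one_le_two, fun p s => ?_,
    fun q t => ?_, hhh, fun q => ?_⟩
  · have h1 := hhh p s s
    rw [if_pos rfl] at h1
    have h2 := norm_le_norm_add_norm_sub' (k (φ p s) * H p s * star (k (φ p s) * H p s))
      (c (φ p s) * star (c (φ p s)))
    rw [CStarRing.norm_self_mul_star, CStarRing.norm_self_mul_star] at h2
    have h3 := hc1 (φ p s)
    exact abs_le_of_sq_le_sq' (by nlinarith [norm_nonneg (c (φ p s))]) zero_le_two |>.2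
  · refine norm_le_of_sum_mul_star (W q) zero_le_two ?_ t
    have h1 := norm_le_norm_add_norm_sub' (∑ t, W q t * star (W q t)) 1
    linarith [hWW q, norm_one_le A]
  -- The three thirds of `ε`: the lower witness itself, replacing `a` by `y y⋆`, and inserting `c
  -- c⋆`.
  · have h1 : ∑ t, W q t * (c (ψ q t) * star (c (ψ q t))) * star (W q t) - 1 =
        (∑ t, W q t * star (W q t) - 1) -
          ∑ t, W q t * (1 - c (ψ q t) * star (c (ψ q t))) * star (W q t) := by
      simp only [mul_sub, sub_mul, Finset.sum_sub_distrib, mul_one]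
      abel
    rw [h1]
    refine (norm_sub_le _ _).trans ?_
    have h2 : ∀ t, ‖W q t * (1 - c (ψ q t) * star (c (ψ q t))) * star (W q t)‖ ≤
        D * (r * 2 * L) * D := by
      intro t
      have h3 : corner A (W q t * (1 - c (ψ q t) * star (c (ψ q t))) * star (W q t)) =
          corner A 1 * (d q t * (y (ψ q t) * star (y (ψ q t)) -
            y (ψ q t) * corner A (c (ψ q t) * star (c (ψ q t))) * star (y (ψ q t))) *
            star (d q t)) * corner A 1 := by
        rw [map_mul, map_mul, map_star, ← hyW, map_sub]
        simp only [star_mul, star_corner_one, mul_sub, sub_mul, mul_assoc]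
        have h4 : ∀ v : Stab A, y (ψ q t) * (corner A 1 * v) = y (ψ q t) * v := fun v => by
          rw [← mul_assoc, hyp]
        simp only [h4]
      rw [← norm_corner, h3]
      refine (norm_corner_conj_le _).trans (norm_conj_le_of_le (hD q t) ?_)
      exact norm_mul_cutoff_le (hcs _) (hyG _) (hyp _) hr0.le (hyL _) (hc1 _) (hcut _)
    have h4 := (norm_sum_le _ _).trans ((Finset.sum_le_sum (s := Finset.univ)
      (g := fun _ => D * (r * 2 * L) * D) fun t _ => h2 t))
    simp only [Finset.sum_const, Finset.card_univ, Fintype.card_fin, nsmul_eq_mul] at h4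
    linarith [hWW q]

end Witnesses

/-! ### From approximate witnesses back to solutions -/

section Stability

attribute [local instance] CStarAlgebra.spectralOrder CStarAlgebra.spectralOrderedRing

variable {A : Type u} [CStarAlgebra A]

/-- `k = (e - κ) γ(e)²`, where `γ` vanishes up to `κ` and is `1` from `2κ` on. The form `g (e - κ)
g` makes `k` a conjugate of `e - κ`, hence dominated by the same conjugate of anything that lies
above `e - κ`. -/
theorem exists_truncation {e : A} (he : 0 ≤ e) {κ : ℝ} (hκ : 0 < κ) :
    ∃ g k : A, IsSelfAdjoint g ∧ 0 ≤ k ∧ k = g * e * g - κ • (g * g) ∧ ‖k - e‖ ≤ 2 * κ := by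
  let γ : ℝ → ℝ := fun t => min 1 (max (t - κ) 0 / κ)
  have hγ : Continuous γ := by fun_prop
  have hk : cfc γ e * e * cfc γ e - κ • (cfc γ e * cfc γ e) =
      cfc (fun t : ℝ => γ t * t * γ t - κ • (γ t * γ t)) e := by
    rw [cfc_sub (fun t : ℝ => γ t * t * γ t) (fun t : ℝ => κ • (γ t * γ t)) e (by fun_prop)
        (by fun_prop), cfc_smul κ (fun t : ℝ => γ t * γ t) e (by fun_prop),
      cfc_mul γ γ e hγ.continuousOn hγ.continuousOn,
      cfc_mul (fun t : ℝ => γ t * t) γ e (by fun_prop) hγ.continuousOn,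
      cfc_mul γ (fun t : ℝ => t) e hγ.continuousOn (by fun_prop), cfc_id' ℝ e]
  have hval : ∀ t : ℝ, 0 ≤ t → 0 ≤ γ t * t * γ t - κ • (γ t * γ t) ∧
      |γ t * t * γ t - κ • (γ t * γ t) - t| ≤ 2 * κ := by
    intro t ht
    have h0 : γ t * t * γ t - κ • (γ t * γ t) = (t - κ) * (γ t) ^ 2 := by
      simp only [smul_eq_mul]; ring
    rw [h0]
    rcases le_total t κ with h | h
    · have h1 : γ t = 0 := by
        simp only [γ, max_eq_right (sub_nonpos.2 h), zero_div]
        exact min_eq_right zero_le_one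
      rw [h1]
      simp only [ne_eq, OfNat.ofNat_ne_zero, not_false_eq_true, zero_pow, mul_zero, le_refl,
        zero_sub, abs_neg, abs_of_nonneg ht, true_and]
      linarith
    · have h1 : γ t ≤ 1 := min_le_left _ _
      have h2 : 0 ≤ γ t := le_min zero_le_one (by positivity)
      have h3 : 0 ≤ t - κ := sub_nonneg.2 h
      refine ⟨by positivity, ?_⟩
      have h4 : (γ t) ^ 2 ≤ 1 := pow_le_one₀ h2 h1
      rw [abs_le]
      refine ⟨?_, by nlinarith⟩
      rcases le_total (t - κ) κ with h5 | h5
      · nlinarith [mul_nonneg h3 (sq_nonneg (γ t))]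
      · have h6 : γ t = 1 := by
          refine min_eq_left ?_
          rw [max_eq_left h3, one_le_div hκ]
          exact h5
        rw [h6]
        linarith
  refine ⟨cfc γ e, _, cfc_predicate _ _, ?_, rfl, ?_⟩
  · rw [hk]
    exact cfc_nonneg fun t ht => (hval t (spectrum_nonneg_of_nonneg he ht)).1
  · rw [hk]
    nth_rewrite 2 [← cfc_id' ℝ e]
    rw [← cfc_sub (fun t : ℝ => γ t * t * γ t - κ • (γ t * γ t)) (fun t : ℝ => t) e (by fun_prop)
      (by fun_prop)]
    refine norm_cfc_le (by positivity) fun t ht => ?_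
    rw [Real.norm_eq_abs]
    exact (hval t (spectrum_nonneg_of_nonneg he ht)).2

/-- The block diagonal matrix with diagonal `d`. -/
def MatN.diag {m : ℕ} (d : Fin m → A) : MatN A m := ∑ s : Fin m, MatN.single m s s (d s)

theorem MatN.diag_mul_diag {m : ℕ} (d d' : Fin m → A) :
    diag d * diag d' = diag fun s => d s * d' s := by
  rw [diag, diag, Finset.sum_mul_sum, diag]
  refine Finset.sum_congr rfl fun s _ => ?_
  rw [Finset.sum_eq_single s]
  · rw [single_mul, if_pos ⟨rfl, s.2⟩]
  · intro t _ ht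
    rw [single_mul, if_neg fun h => ht (Fin.ext h.1.symm)]
  · simp

theorem MatN.star_diag {m : ℕ} (d : Fin m → A) : star (diag d) = diag fun s => star (d s) := by
  simp only [diag, star_sum, single_star]

theorem MatN.diag_sub_smul {m : ℕ} (d d' : Fin m → A) (r : ℝ) :
    diag (fun s => d s - r • d' s) = diag d - r • diag d' := by
  simp only [diag, Finset.smul_sum, ← Finset.sum_sub_distrib]
  refine Finset.sum_congr rfl fun s _ => ?_
  have h1 : r • d' s = (r : ℂ) • d' s := (Complex.coe_smul r _).symm
  have h2 : r • single m s s (d' s) = (r : ℂ) • single m s s (d' s) := (Complex.coe_smul r _).symm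
  rw [h1, h2, ← single_smul, eq_sub_iff_add_eq, ← single_add, sub_add_cancel]

variable (A) in
/-- The entries of a matrix, as an additive map. -/
def MatN.entryHom {m : ℕ} (p q : Fin m) : MatN A m →+ A where
  toFun x := x.entry p q
  map_zero' := rfl
  map_add' _ _ := rfl

theorem MatN.entry_diag {m : ℕ} (d : Fin m → A) (p q : Fin m) :
    (diag d).entry p q = if p = q then d p else 0 := by
  change entryHom A p q (∑ s : Fin m, single m s s (d s)) = _
  rw [map_sum]
  change ∑ s : Fin m, (if p.1 = s.1 ∧ q.1 = s.1 then d s else 0) = _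
  rw [Finset.sum_eq_single p]
  · simp [Fin.ext_iff, eq_comm]
  · intro s _ hs
    rw [if_neg fun h => hs (Fin.ext h.1.symm)]
  · simp

theorem MatN.entry_mul {m : ℕ} (x y : MatN A m) (p q : Fin m) :
    (x * y).entry p q = ∑ r, x.entry p r * y.entry r q := rfl

/-- If the row `h` is orthogonal up to a small error, then conjugates of its terms are orthogonal
up to an arbitrarily small error. -/
theorem exists_orthogonal {m : ℕ} (h e g k : Fin m → A) {κ : ℝ}
    (hg : ∀ s, IsSelfAdjoint (g s)) (hk0 : ∀ s, 0 ≤ k s)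
    (he : ∀ s, IsSelfAdjoint (e s))
    (hk : ∀ s, k s = g s * e s * g s - κ • (g s * g s))
    (hh : ∑ s, ∑ s', ‖h s * star (h s') - if s = s' then e s else 0‖ ≤ κ) {η : ℝ} (hη : 0 < η) :
    ∃ z : Fin m → A, ∀ s s', ‖z s * star (z s') - if s = s' then k s else 0‖ < η := by
  rcases Nat.eq_zero_or_pos m with rfl | hm
  · exact ⟨fun s => s.elim0, fun s => s.elim0⟩
  -- The terms of `h` form the first column of a matrix, so `H H⋆` has entries `h s * star (h s')`,
  -- and approximate orthogonality says that it is near the diagonal matrix of `e`.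
  set H : MatN A m := ∑ s : Fin m, MatN.single m s 0 (h s) with hH
  have hHH : H * star H = ∑ s : Fin m, ∑ s' : Fin m, MatN.single m s s' (h s * star (h s')) := by
    rw [hH, star_sum, Finset.sum_mul_sum]
    refine Finset.sum_congr rfl fun s _ => Finset.sum_congr rfl fun s' _ => ?_
    rw [MatN.single_star, MatN.single_mul, if_pos ⟨rfl, hm⟩]
  have hdiff : H * star H - MatN.diag e = ∑ s : Fin m, ∑ s' : Fin m,
      MatN.single m s s' (h s * star (h s') - if s = s' then e s else 0) := by
    rw [hHH, sub_eq_iff_eq_add, MatN.diag, ← Finset.sum_add_distrib]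
    refine Finset.sum_congr rfl fun s _ => ?_
    have : MatN.single m s s (e s) =
        ∑ s' : Fin m, MatN.single m s s' (if s = s' then e s else 0) := by
      rw [Finset.sum_eq_single s]
      · rw [if_pos rfl]
      · intro s' _ hs
        rw [if_neg hs.symm]
        simpa using MatN.single_smul m s s' (0 : ℂ) (0 : A)
      · simp
    rw [this, ← Finset.sum_add_distrib]
    refine Finset.sum_congr rfl fun s' _ => ?_
    rw [← MatN.single_add, sub_add_cancel]
  have hnorm : ‖MatN.diag e - H * star H‖ ≤ κ := by
    rw [norm_sub_rev, hdiff]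
    refine le_trans ((norm_sum_le _ _).trans (Finset.sum_le_sum fun s _ => (norm_sum_le _ _).trans
      (Finset.sum_le_sum fun s' _ => MatN.norm_single_le _ _ _ _))) hh
  have hes : IsSelfAdjoint (MatN.diag e) := by
    rw [isSelfAdjoint_iff, MatN.star_diag]
    exact congrArg _ (funext fun s => (he s).star_eq)
  have hgs : IsSelfAdjoint (MatN.diag g) := by
    rw [isSelfAdjoint_iff, MatN.star_diag]
    exact congrArg _ (funext fun s => (hg s).star_eq)
  -- The norm estimate becomes an order relation. Conjugating it by the diagonal of `g` puts the
  -- diagonal of `k` below a conjugate of `H H⋆`, which is then compared to any accuracy.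
  have hle : MatN.diag e - κ • (1 : MatN A m) ≤ H * star H := by
    have h1 : MatN.diag e - H * star H ≤ algebraMap ℝ (MatN A m) ‖MatN.diag e - H * star H‖ :=
      IsSelfAdjoint.le_algebraMap_norm_self (hes.sub (IsSelfAdjoint.mul_star_self H))
    have h2 := h1.trans (algebraMap_mono (MatN A m) hnorm)
    rw [Algebra.algebraMap_eq_smul_one] at h2
    exact sub_le_comm.1 h2
  have hX : MatN.diag g * (MatN.diag e - κ • (1 : MatN A m)) * MatN.diag g = MatN.diag k := by
    rw [mul_sub, sub_mul, mul_smul_comm, mul_one, smul_mul_assoc, MatN.diag_mul_diag,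
      MatN.diag_mul_diag, MatN.diag_mul_diag, ← MatN.diag_sub_smul]
    exact congrArg _ (funext fun s => (hk s).symm)
  have hX0 : 0 ≤ MatN.diag k := by
    choose b hb using fun s => CStarAlgebra.nonneg_iff_eq_star_mul_self.1 (hk0 s)
    have : MatN.diag k = star (MatN.diag b) * MatN.diag b := by
      rw [MatN.star_diag, MatN.diag_mul_diag]
      exact congrArg _ (funext hb)
    rw [this]
    exact star_mul_self_nonneg _
  have hXY := hgs.conjugate_le_conjugate hle
  rw [hX] at hXY
  obtain ⟨x, hx⟩ := exists_conj_of_le hX0 hXY hη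
  set Z := x * MatN.diag g * H with hZ
  -- Left multiplication preserves being supported in the first column, so the entries of `Z Z⋆` are
  -- again single products `z s * star (z s')`.
  have hZ0 : Z = Z * MatN.single m 0 0 1 := by
    have : H = H * MatN.single m 0 0 1 := by
      rw [hH, Finset.sum_mul]
      refine Finset.sum_congr rfl fun s _ => ?_
      rw [MatN.single_mul, if_pos ⟨rfl, hm⟩, mul_one]
    rw [hZ, mul_assoc _ H, ← this]
  have hentry : ∀ s r : Fin m, r ≠ ⟨0, hm⟩ → Z.entry s r = 0 := by
    intro s r hr
    rw [hZ0, MatN.entry_mul]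
    refine Finset.sum_eq_zero fun t _ => ?_
    have : (MatN.single m 0 0 (1 : A)).entry t r = 0 := if_neg fun h => hr (Fin.ext h.2)
    rw [this, mul_zero]
  refine ⟨fun s => Z.entry s ⟨0, hm⟩, fun s s' => lt_of_le_of_lt ?_ hx⟩
  have h1 : (Z * star Z - MatN.diag k).entry s s' =
      Z.entry s ⟨0, hm⟩ * star (Z.entry s' ⟨0, hm⟩) - if s = s' then k s else 0 := by
    rw [← MatN.entry_diag k s s']
    change (Z * star Z).entry s s' - _ = _
    rw [MatN.entry_mul, Finset.sum_eq_single ⟨0, hm⟩]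
    · rfl
    · intro r _ hr
      rw [hentry s r hr, zero_mul]
    · simp
  rw [← h1]
  refine (MatN.norm_entry_le _ s s').trans (le_of_eq ?_)
  congr 2
  rw [hZ, star_mul, star_mul, hgs.star_eq]
  simp only [mul_assoc]

/-- Approximate solutions of bounded norm can be corrected to solutions. -/
theorem exists_solvable_of_approxSolvable (m n : ℕ) : ∃ ε : ℝ, 0 < ε ∧ ε ≤ 1 ∧
    ∀ (A : Type u) [CStarAlgebra A] (J P Q : Type) (φ : P → Fin m → J) (ψ : Q → Fin n → J),
      ApproxSolvable A φ ψ ε 3 → Solvable A φ ψ := by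
  -- Truncation changes each of the `n` terms of a lower sum by at most `3 * 2κ * 3`, in total at
  -- most `1/4`. With `ε ≤ 1/4` the sum stays within `1/2` of the unit, as `exists_conj_one`
  -- requires. The factor `m * m + 1` in `ε` accounts for the sum over matrix entries in
  -- `exists_orthogonal`.
  set κ : ℝ := 1 / (72 * (n + 1)) with hκ
  have hκ0 : 0 < κ := by positivity
  refine ⟨min (1 / 4) (κ / (m * m + 1)), by positivity, (min_le_left _ _).trans (by norm_num), ?_⟩
  intro A _ J P Q φ ψ ⟨c, h, w, hc, _, hw, hh, hsum⟩
  choose g k hg hk0 hk hke using fun j => exists_truncation (mul_star_self_nonneg (c j)) hκ0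
  choose b hb using fun j => CStarAlgebra.nonneg_iff_eq_star_mul_self.1 (hk0 j)
  let a : J → PosElt A := fun j => ⟨corner A (k j), corner A (b j), by
    rw [hb, map_mul, map_star]⟩
  refine ⟨fun j => Cu.mk (a j), fun p => ?_, fun q => ?_⟩
  · refine (sum_mk_le_iff (fun s => a (φ p s)) _).2 fun η hη => ?_
    have h1 : ∑ s, ∑ s', ‖h p s * star (h p s') -
        if s = s' then c (φ p s) * star (c (φ p s)) else 0‖ ≤ κ := by
      refine (Finset.sum_le_sum fun s _ => Finset.sum_le_sum fun s' _ =>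
        (hh p s s').trans (min_le_right _ _)).trans ?_
      simp only [Finset.sum_const, Finset.card_univ, Fintype.card_fin, nsmul_eq_mul]
      rw [← mul_assoc, mul_div_assoc', div_le_iff₀ (by positivity)]
      nlinarith
    obtain ⟨z, hz⟩ := exists_orthogonal (h p) (fun s => c (φ p s) * star (c (φ p s)))
      (fun s => g (φ p s)) (fun s => k (φ p s)) (fun s => hg _) (fun s => hk0 _)
      (fun s => IsSelfAdjoint.mul_star_self _) (fun s => hk _) h1 hη
    refine ⟨fun s => corner A (z s), fun s s' => lt_of_eq_of_lt ?_ (hz s s')⟩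
    rw [← norm_corner, map_sub, map_mul, map_star, apply_ite (corner A), map_zero]
    congr 3
    change corner A (z s) * corner A 1 = _
    rw [← map_mul, mul_one]
  · refine (le_sum_mk_iff (fun t => a (ψ q t)) _).2 fun η hη => ?_
    have hr : ‖∑ t, w q t * k (ψ q t) * star (w q t) - 1‖ ≤ 1 / 2 := by
      have h1 : ∑ t, w q t * k (ψ q t) * star (w q t) - 1 =
          (∑ t, w q t * (c (ψ q t) * star (c (ψ q t))) * star (w q t) - 1) +
          ∑ t, w q t * (k (ψ q t) - c (ψ q t) * star (c (ψ q t))) * star (w q t) := by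
        simp only [mul_sub, sub_mul, Finset.sum_sub_distrib]
        abel
      rw [h1]
      refine (norm_add_le _ _).trans ?_
      have h2 := (norm_sum_le _ _).trans (Finset.sum_le_sum (s := Finset.univ)
        (g := fun _ => 3 * (2 * κ) * 3) fun t _ =>
          norm_conj_le_of_le (hw q t) (hke (ψ q t)))
      simp only [Finset.sum_const, Finset.card_univ, Fintype.card_fin, nsmul_eq_mul] at h2
      have h3 : (n : ℝ) * (3 * (2 * κ) * 3) ≤ 1 / 4 := by
        rw [hκ, show (n : ℝ) * (3 * (2 * (1 / (72 * (n + 1)))) * 3) = 1 / 4 * (n / (n + 1)) by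
          field_simp; ring]
        exact mul_le_of_le_one_right (by norm_num) ((div_le_one (by positivity)).2 (by linarith))
      have h4 := (hsum q).trans (min_le_left _ _)
      linarith
    have hrs : IsSelfAdjoint (∑ t, w q t * k (ψ q t) * star (w q t)) :=
      isSelfAdjoint_sum _ fun t _ => (hk0 (ψ q t)).isSelfAdjoint.conjugate (w q t)
    obtain ⟨x, hx⟩ := exists_conj_one hrs hr hη
    refine ⟨fun t => corner A (x * w q t), lt_of_eq_of_lt ?_ hx⟩
    rw [← norm_corner, map_sub, Finset.mul_sum, Finset.sum_mul, map_sum]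
    congr 2
    refine Finset.sum_congr rfl fun t _ => ?_
    change corner A (x * w q t) * corner A (k (ψ q t)) * star (corner A (x * w q t)) = _
    rw [← map_star, ← map_mul, ← map_mul, star_mul]
    simp only [mul_assoc]

end Stability

/-! ### Transfer of approximate witnesses to products and quotients -/

section Products

variable {A : ℕ → Type u} [∀ k, CStarAlgebra (A k)]

/-- The `k`-th coordinate as an additive map. -/
def BProd.coordHom (k : ℕ) : BProd A →+ A k where
  toFun a := a.coord k
  map_zero' := rfl
  map_add' _ _ := rfl

theorem BProd.coord_ite (k : ℕ) (p : Prop) [Decidable p] (a : BProd A) :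
    (if p then a else 0).coord k = if p then a.coord k else 0 := by
  split_ifs <;> rfl

theorem BProd.coord_sum_conj {n : ℕ} (w e : Fin n → BProd A) (k : ℕ) :
    (∑ t, w t * e t * star (w t) - 1).coord k =
      ∑ t, (w t).coord k * (e t).coord k * star ((w t).coord k) - 1 := by
  change BProd.coordHom k (∑ t, w t * e t * star (w t) - 1) = _
  rw [map_sub, map_sum]
  rfl

theorem ApproxSolvable.mono {B : Type u} [CStarAlgebra B] {J P Q : Type} {m n : ℕ}
    {φ : P → Fin m → J} {ψ : Q → Fin n → J} {ε K K' : ℝ} (h : ApproxSolvable B φ ψ ε K)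
    (hK : K ≤ K') : ApproxSolvable B φ ψ ε K' := by
  obtain ⟨c, h, w, hc, hh, hw, h1, h2⟩ := h
  exact ⟨c, h, w, fun j => (hc j).trans hK, fun p s => (hh p s).trans hK,
    fun q t => (hw q t).trans hK, h1, h2⟩

variable {J P Q : Type} {m n : ℕ} {φ : P → Fin m → J} {ψ : Q → Fin n → J}

theorem ApproxSolvable.of_bprod {ε K : ℝ} (h : ApproxSolvable (BProd A) φ ψ ε K) (k : ℕ) :
    ApproxSolvable (A k) φ ψ ε K := by
  obtain ⟨c, h, w, hc, hh, hw, h1, h2⟩ := h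
  refine ⟨fun j => (c j).coord k, fun p s => (h p s).coord k, fun q t => (w q t).coord k,
    fun j => ((c j).norm_coord_le k).trans (hc j), fun p s => ((h p s).norm_coord_le k).trans
    (hh p s), fun q t => ((w q t).norm_coord_le k).trans (hw q t), fun p s s' => ?_, fun q => ?_⟩
  · have h3 := (BProd.norm_coord_le _ k).trans (h1 p s s')
    rwa [BProd.coord_sub, BProd.coord_ite] at h3
  · have h3 := (BProd.norm_coord_le _ k).trans (h2 q)
    rwa [BProd.coord_sum_conj] at h3

/-- Bounded approximate solutions at almost all coordinates assemble to elements of the product. -/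
theorem exists_bprod_witnesses {ε K : ℝ} (hK : 0 ≤ K) (S : Set ℕ)
    (h : ∀ k ∈ S, ApproxSolvable (A k) φ ψ ε K) :
    ∃ (c : J → BProd A) (h : P → Fin m → BProd A) (w : Q → Fin n → BProd A),
      (∀ j, ‖c j‖ ≤ K) ∧ (∀ p s, ‖h p s‖ ≤ K) ∧ (∀ q t, ‖w q t‖ ≤ K) ∧
      (∀ p s s', ∀ k ∈ S, ‖(h p s * star (h p s') -
        if s = s' then c (φ p s) * star (c (φ p s)) else 0).coord k‖ ≤ ε) ∧
      ∀ q, ∀ k ∈ S,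
        ‖(∑ t, w q t * (c (ψ q t) * star (c (ψ q t))) * star (w q t) - 1).coord k‖ ≤ ε := by
  have h' : ∀ k, ∃ (c : J → A k) (h : P → Fin m → A k) (w : Q → Fin n → A k),
      (∀ j, ‖c j‖ ≤ K) ∧ (∀ p s, ‖h p s‖ ≤ K) ∧ (∀ q t, ‖w q t‖ ≤ K) ∧ (k ∈ S →
      (∀ p s s', ‖h p s * star (h p s') -
        if s = s' then c (φ p s) * star (c (φ p s)) else 0‖ ≤ ε) ∧
      ∀ q, ‖∑ t, w q t * (c (ψ q t) * star (c (ψ q t))) * star (w q t) - 1‖ ≤ ε) := by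
    intro k
    by_cases hk : k ∈ S
    · obtain ⟨c, h, w, hc, hh, hw, h1⟩ := h k hk
      exact ⟨c, h, w, hc, hh, hw, fun _ => h1⟩
    -- Zeros outside `S` keep the sequences bounded by `K`; no relation is claimed there.
    · exact ⟨0, 0, 0, by simpa using fun _ => hK, by simpa using fun _ _ => hK,
        by simpa using fun _ _ => hK, fun h => absurd h hk⟩
  choose c h w hc hh hw h1 using h'
  refine ⟨fun j => BProd.mk (fun k => c k j) K fun k => hc k j,
    fun p s => BProd.mk (fun k => h k p s) K fun k => hh k p s,
    fun q t => BProd.mk (fun k => w k q t) K fun k => hw k q t,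
    fun j => BProd.norm_le hK fun k => hc k j, fun p s => BProd.norm_le hK fun k => hh k p s,
    fun q t => BProd.norm_le hK fun k => hw k q t, fun p s s' k hk => ?_, fun q k hk => ?_⟩
  · rw [BProd.coord_sub, BProd.coord_ite]
    exact (h1 k hk).1 p s s'
  · rw [BProd.coord_sum_conj]
    exact (h1 k hk).2 q

theorem ApproxSolvable.bprod {ε K : ℝ} (hε : 0 ≤ ε) (hK : 0 ≤ K)
    (h : ∀ k, ApproxSolvable (A k) φ ψ ε K) : ApproxSolvable (BProd A) φ ψ ε K := by
  obtain ⟨c, h, w, hc, hh, hw, h1, h2⟩ := exists_bprod_witnesses hK Set.univ fun k _ => h k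
  exact ⟨c, h, w, hc, hh, hw, fun p s s' => BProd.norm_le hε fun k => h1 p s s' k trivial,
    fun q => BProd.norm_le hε fun k => h2 q k trivial⟩

theorem RProd.mk_relation (ω : Filter ℕ) (x y c : BProd A) (p : Prop) [Decidable p] :
    RProd.mk ω (x * star y - if p then c * star c else 0) =
      RProd.mk ω x * star (RProd.mk ω y) -
        if p then RProd.mk ω c * star (RProd.mk ω c) else 0 := by
  rw [map_sub, map_mul, RProd.star_mk, RProd.star_mk, apply_ite (RProd.mk ω), map_mul, map_zero]

theorem RProd.mk_sum_conj (ω : Filter ℕ) (w c : Fin n → BProd A) :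
    RProd.mk ω (∑ t, w t * (c t * star (c t)) * star (w t) - 1) =
      ∑ t, RProd.mk ω (w t) * (RProd.mk ω (c t) * star (RProd.mk ω (c t))) *
        star (RProd.mk ω (w t)) - 1 := by
  simp only [map_sub, map_sum, map_mul, map_one, RProd.star_mk]

theorem ApproxSolvable.rprod {ε K : ℝ} (hε : 0 ≤ ε) (hK : 0 ≤ K) {ω : Filter ℕ}
    (h : ∀ᶠ k in ω, ApproxSolvable (A k) φ ψ ε K) : ApproxSolvable (RProd A ω) φ ψ ε K := by
  obtain ⟨c, h, w, hc, hh, hw, h1, h2⟩ := exists_bprod_witnesses hK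
    {k | ApproxSolvable (A k) φ ψ ε K} fun k hk => hk
  refine ⟨fun j => RProd.mk ω (c j), fun p s => RProd.mk ω (h p s), fun q t => RProd.mk ω (w q t),
    fun j => (RProd.norm_mk_le ω _).trans (hc j), fun p s => (RProd.norm_mk_le ω _).trans (hh p s),
    fun q t => (RProd.norm_mk_le ω _).trans (hw q t), fun p s s' => ?_, fun q => ?_⟩
  · rw [← RProd.mk_relation]
    refine RProd.norm_le hε ?_
    filter_upwards [‹∀ᶠ k in ω, ApproxSolvable (A k) φ ψ ε K›] with k hk using h1 p s s' k hk
  · rw [← RProd.mk_sum_conj]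
    refine RProd.norm_le hε ?_
    filter_upwards [‹∀ᶠ k in ω, ApproxSolvable (A k) φ ψ ε K›] with k hk using h2 q k hk

/-- Lifts from the quotient exist with arbitrarily little extra norm, and a strict norm bound in the
quotient holds at almost all coordinates of a lift; hence the slack in both constants. Finiteness of
the index sets allows the finitely many relations to be imposed at once. -/
theorem ApproxSolvable.eventually_of_rprod [Finite P] [Finite Q] {ε ε' K K' : ℝ} (hε : ε < ε')
    (hK : K < K') {ω : Filter ℕ} (h : ApproxSolvable (RProd A ω) φ ψ ε K) :
    ∀ᶠ k in ω, ApproxSolvable (A k) φ ψ ε' K' := by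
  obtain ⟨c, h, w, hc, hh, hw, h1, h2⟩ := h
  have hlift : ∀ x : RProd A ω, ‖x‖ ≤ K → ∃ a : BProd A, RProd.mk ω a = x ∧ ‖a‖ ≤ K' := by
    intro x hx
    obtain ⟨a, ha, h3⟩ := RProd.exists_norm_lt x (sub_pos.2 hK)
    exact ⟨a, ha, by linarith⟩
  choose c' hc' hcK using fun j => hlift (c j) (hc j)
  choose h' hh' hhK using fun p s => hlift (h p s) (hh p s)
  choose w' hw' hwK using fun q t => hlift (w q t) (hw q t)
  have e1 : ∀ᶠ k in ω, ∀ p s s', ‖(h' p s * star (h' p s') -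
      if s = s' then c' (φ p s) * star (c' (φ p s)) else 0).coord k‖ < ε' := by
    simp only [eventually_all]
    intro p s s'
    refine RProd.eventually_lt ?_
    rw [RProd.mk_relation, hh', hh', hc']
    exact (h1 p s s').trans_lt hε
  have e2 : ∀ᶠ k in ω, ∀ q,
      ‖(∑ t, w' q t * (c' (ψ q t) * star (c' (ψ q t))) * star (w' q t) - 1).coord k‖ < ε' := by
    rw [eventually_all]
    intro q
    refine RProd.eventually_lt ?_
    rw [RProd.mk_sum_conj]
    simp only [hw', hc']
    exact (h2 q).trans_lt hε
  filter_upwards [e1, e2] with k h3 h4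
  refine ⟨fun j => (c' j).coord k, fun p s => (h' p s).coord k, fun q t => (w' q t).coord k,
    fun j => ((c' j).norm_coord_le k).trans (hcK j), fun p s => ((h' p s).norm_coord_le k).trans
    (hhK p s), fun q t => ((w' q t).norm_coord_le k).trans (hwK q t), fun p s s' => ?_,
    fun q => ?_⟩
  · have h5 := (h3 p s s').le
    rwa [BProd.coord_sub, BProd.coord_ite] at h5
  · have h5 := (h4 q).le
    rwa [BProd.coord_sum_conj] at h5

variable [Fintype J] [Fintype Q]

/-- One `ε` serves the product and all its factors, so approximate witnesses travel in either
direction and are corrected at the destination. -/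
theorem solvable_bprod_iff (A : ℕ → Type u) [∀ k, CStarAlgebra (A k)]
    (hφ : ∀ j, ∃ p s, φ p s = j) :
    Solvable (BProd A) φ ψ ↔ ∀ k, Solvable (A k) φ ψ := by
  obtain ⟨ε, hε, hε1, hstab⟩ := exists_solvable_of_approxSolvable.{u} m n
  constructor
  · intro h k
    exact hstab _ _ _ _ _ _
      (((h.approxSolvable hφ hε hε1).of_bprod k).mono (by norm_num))
  · intro h
    exact hstab _ _ _ _ _ _ ((ApproxSolvable.bprod hε.le zero_le_two
      fun k => (h k).approxSolvable hφ hε hε1).mono (by norm_num))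

theorem solvable_rprod_iff [Finite P] (A : ℕ → Type u) [∀ k, CStarAlgebra (A k)] (ω : Filter ℕ)
    (hφ : ∀ j, ∃ p s, φ p s = j) :
    Solvable (RProd A ω) φ ψ ↔ ∀ᶠ k in ω, Solvable (A k) φ ψ := by
  obtain ⟨ε, hε, hε1, hstab⟩ := exists_solvable_of_approxSolvable.{u} m n
  constructor
  · intro h
    -- Starting from `ε / 2` and norm bound 2 leaves room for the lift, which must satisfy the
    -- relations up to `ε` with norm bound 3.
    filter_upwards [(h.approxSolvable hφ (half_pos hε) (by linarith)).eventually_of_rprod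
      (half_lt_self hε) (show (2 : ℝ) < 3 by norm_num)] with k hk
    exact hstab _ _ _ _ _ _ hk
  · intro h
    refine hstab _ _ _ _ _ _ ((ApproxSolvable.rprod hε.le zero_le_two ?_).mono (by norm_num))
    filter_upwards [h] with k hk using hk.approxSolvable hφ hε hε1

end Products

/-! ### From solvability to the divisibility numbers -/

section Numbers

variable {A : Type u} [CStarAlgebra A]

theorem CompactlyContained.le {S : Type u} [PartialOrder S] [AddCommMonoid S] {u v : S}
    (h : CompactlyContained u v) : u ≤ v :=
  (h (fun _ => v) monotone_const (by simp)).elim fun _ hi => hi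

/-- Compactness allows `u' = ⟨1⟩` as a test element, and `u' ≪ ⟨1⟩` always gives `u' ≤ ⟨1⟩`, so this
test element is the hardest. Here a single unknown is repeated; the next two equivalences use the
same argument with other index patterns. -/
theorem isDivisible_unitClass_iff (m n : ℕ) : IsDivisible m n (unitClass A) ↔
    Solvable A (fun (_ : Unit) (_ : Fin m) => ()) (fun (_ : Unit) (_ : Fin n) => ()) := by
  constructor
  · intro h
    obtain ⟨x, h1, h2⟩ := h _ compactlyContained_unitClass
    exact ⟨fun _ => x, fun _ => by simpa using h1, fun _ => by simpa using h2⟩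
  · rintro ⟨x, h1, h2⟩ u' hu'
    exact ⟨x (), by simpa using h1 (), by simpa using hu'.le.trans (h2 ())⟩

theorem isDecomposable_unitClass_iff (m n : ℕ) : IsDecomposable m n (unitClass A) ↔
    Solvable A (fun (_ : Unit) (s : Fin m) => s) (fun (j : Fin m) (_ : Fin n) => j) := by
  constructor
  · intro h
    obtain ⟨x, h1, h2⟩ := h _ compactlyContained_unitClass
    exact ⟨x, fun _ => h1, fun j => by simpa using h2 j⟩
  · rintro ⟨x, h1, h2⟩ u' hu'
    exact ⟨x, h1 (), fun j => by simpa using hu'.le.trans (h2 j)⟩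

theorem isWeaklyDivisible_unitClass_iff (m n : ℕ) : IsWeaklyDivisible m n (unitClass A) ↔
    Solvable A (fun (j : Fin n) (_ : Fin m) => j) (fun (_ : Unit) (t : Fin n) => t) := by
  constructor
  · intro h
    obtain ⟨x, h1, h2⟩ := h _ compactlyContained_unitClass
    exact ⟨x, fun j => by simpa using h1 j, fun _ => h2⟩
  · rintro ⟨x, h1, h2⟩ u' hu'
    exact ⟨x, fun j => by simpa using h1 j, hu'.le.trans (h2 ())⟩

theorem Cu.le_add_right' (x y : Cu A) : x ≤ x + y := by
  have h : x + 0 ≤ x + y := by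
    induction x using Cu.ind with | _ a
    induction y using Cu.ind with | _ b
    rw [Cu.zero_def, Cu.mk_add_mk, Cu.mk_add_mk]
    exact PosElt.oplus_le_oplus (le_refl a) fun ε hε => ⟨0, by simpa using hε⟩
  rwa [add_zero] at h

theorem IsDivisible.succ {m n : ℕ} {u : Cu A} (h : IsDivisible m n u) :
    IsDivisible m (n + 1) u := by
  intro u' hu'
  obtain ⟨x, h1, h2⟩ := h u' hu'
  exact ⟨x, h1, h2.trans (by rw [succ_nsmul]; exact Cu.le_add_right' _ _)⟩

theorem IsDecomposable.succ {m n : ℕ} {u : Cu A} (h : IsDecomposable m n u) :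
    IsDecomposable m (n + 1) u := by
  intro u' hu'
  obtain ⟨x, h1, h2⟩ := h u' hu'
  exact ⟨x, h1, fun j => (h2 j).trans (by rw [succ_nsmul]; exact Cu.le_add_right' _ _)⟩

theorem IsWeaklyDivisible.succ {m n : ℕ} {u : Cu A} (h : IsWeaklyDivisible m n u) :
    IsWeaklyDivisible m (n + 1) u := by
  intro u' hu'
  obtain ⟨x, h1, h2⟩ := h u' hu'
  -- The additional summand is `0`, which satisfies every upper estimate because `0` is the least
  -- element.
  refine ⟨Fin.snoc x 0, fun j => ?_, by simpa [Fin.sum_univ_castSucc] using h2⟩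
  refine Fin.lastCases ?_ (fun j => ?_) j
  · simpa using Cu.le_add_right' 0 u
  · simpa using h1 j

theorem one_le_leastPos (p : ℕ → Prop) : 1 ≤ leastPos p := by
  refine le_sInf ?_
  rintro _ ⟨n, hn, _, rfl⟩
  exact_mod_cast hn

/-- For a property that persists upwards, the bounds `≤ n` determine the least number; comparing
such bounds replaces all arithmetic with infima. -/
theorem leastPos_le_iff {p : ℕ → Prop} (hp : ∀ n, p n → p (n + 1)) {n : ℕ} (hn : 1 ≤ n) :
    leastPos p ≤ n ↔ p n := by
  refine ⟨fun h => ?_, fun h => sInf_le ⟨n, hn, h, rfl⟩⟩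
  have h1 : leastPos p < (n : ℕ∞) + 1 := (ENat.lt_add_one_iff (ENat.natCast_ne_top n)).2 h
  obtain ⟨_, ⟨k, _, hk, rfl⟩, h2⟩ := sInf_lt_iff.1 h1
  have h3 : k ≤ n := by
    have h4 : (k : ℕ∞) < ((n + 1 : ℕ) : ℕ∞) := by exact_mod_cast h2
    exact Nat.lt_succ_iff.1 (by exact_mod_cast h4)
  exact Nat.le_induction hk (fun l _ => hp l) n h3

/-- The lower bounds are needed since tests with `n ≥ 1` do not distinguish `0` from `1`. -/
theorem enat_eq_of_le_iff {x y : ℕ∞} (hx : 1 ≤ x) (hy : 1 ≤ y)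
    (h : ∀ n : ℕ, 1 ≤ n → (x ≤ n ↔ y ≤ n)) : x = y := by
  apply le_antisymm
  · induction y using ENat.recTopCoe with
    | top => exact le_top
    | coe n => exact (h n (by exact_mod_cast hy)).2 le_rfl
  · induction x using ENat.recTopCoe with
    | top => exact le_top
    | coe n => exact (h n (by exact_mod_cast hx)).1 le_rfl

theorem leastPos_eq_iSup {p : ℕ → Prop} {q : ℕ → ℕ → Prop} (hp : ∀ n, p n → p (n + 1))
    (hq : ∀ k n, q k n → q k (n + 1)) (h : ∀ n, p n ↔ ∀ k, q k n) :
    leastPos p = ⨆ k, leastPos (q k) := by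
  refine enat_eq_of_le_iff (one_le_leastPos p)
    ((one_le_leastPos (q 0)).trans (le_iSup (fun k => leastPos (q k)) 0)) fun n hn => ?_
  rw [leastPos_le_iff hp hn, h, iSup_le_iff]
  exact forall_congr' fun k => (leastPos_le_iff (hq k) hn).symm

theorem leastPos_eq_limsup {p : ℕ → Prop} {q : ℕ → ℕ → Prop} {ω : Filter ℕ} [ω.NeBot]
    (hp : ∀ n, p n → p (n + 1)) (hq : ∀ k n, q k n → q k (n + 1))
    (h : ∀ n, p n ↔ ∀ᶠ k in ω, q k n) : leastPos p = limsup (fun k => leastPos (q k)) ω := by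
  refine enat_eq_of_le_iff (one_le_leastPos p)
    (le_limsup_of_frequently_le (Frequently.of_forall fun k => one_le_leastPos (q k)))
    fun n hn => ?_
  rw [leastPos_le_iff hp hn, h]
  constructor
  · intro hev
    refine limsup_le_of_le (h := ?_)
    filter_upwards [hev] with k hk using (leastPos_le_iff (hq k) hn).2 hk
  · intro hle
    -- The bound `≤ n` is rewritten as `< n + 1`, because only a strict bound on a `limsup` passes
    -- to almost all terms.
    filter_upwards [eventually_lt_of_limsup_lt
      ((ENat.lt_add_one_iff (ENat.natCast_ne_top n)).2 hle)] with k hk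
    exact (leastPos_le_iff (hq k) hn).1 ((ENat.lt_add_one_iff (ENat.natCast_ne_top n)).1 hk)

end Numbers

end CuntzDiv

end

theorem mainTheorem7 (A : ℕ → Type*) [∀ k, CStarAlgebra (A k)] (m : ℕ) (hm : 2 ≤ m) :
    ((CuntzDiv.bigDiv m (CuntzDiv.BProd A) = ⨆ k, CuntzDiv.bigDiv m (A k)) ∧
      (CuntzDiv.decDiv m (CuntzDiv.BProd A) = ⨆ k, CuntzDiv.decDiv m (A k)) ∧
      (CuntzDiv.weakDiv m (CuntzDiv.BProd A) = ⨆ k, CuntzDiv.weakDiv m (A k))) ∧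
    ∀ ω : Filter ℕ, ω.NeBot → ⋂₀ ω.sets = ∅ →
      ((CuntzDiv.bigDiv m (CuntzDiv.RProd A ω) =
          Filter.limsup (fun k => CuntzDiv.bigDiv m (A k)) ω) ∧
        (CuntzDiv.decDiv m (CuntzDiv.RProd A ω) =
          Filter.limsup (fun k => CuntzDiv.decDiv m (A k)) ω) ∧
        (CuntzDiv.weakDiv m (CuntzDiv.RProd A ω) =
          Filter.limsup (fun k => CuntzDiv.weakDiv m (A k)) ω)) := by
  -- A summand index: it witnesses that every unknown occurs in an upper inequality, which the
  -- transfer requires and which would fail for empty sums.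
  have s₀ : Fin m := ⟨0, by omega⟩
  refine ⟨⟨?_, ?_, ?_⟩, fun ω hω _ => ⟨?_, ?_, ?_⟩⟩
  · refine CuntzDiv.leastPos_eq_iSup (fun _ => CuntzDiv.IsDivisible.succ)
      (fun _ _ => CuntzDiv.IsDivisible.succ) fun n => ?_
    simp only [CuntzDiv.isDivisible_unitClass_iff]
    exact CuntzDiv.solvable_bprod_iff A fun _ => ⟨(), s₀, rfl⟩
  · refine CuntzDiv.leastPos_eq_iSup (fun _ => CuntzDiv.IsDecomposable.succ)
      (fun _ _ => CuntzDiv.IsDecomposable.succ) fun n => ?_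
    simp only [CuntzDiv.isDecomposable_unitClass_iff]
    exact CuntzDiv.solvable_bprod_iff A fun j => ⟨(), j, rfl⟩
  · refine CuntzDiv.leastPos_eq_iSup (fun _ => CuntzDiv.IsWeaklyDivisible.succ)
      (fun _ _ => CuntzDiv.IsWeaklyDivisible.succ) fun n => ?_
    simp only [CuntzDiv.isWeaklyDivisible_unitClass_iff]
    exact CuntzDiv.solvable_bprod_iff A fun j => ⟨j, s₀, rfl⟩
  · refine CuntzDiv.leastPos_eq_limsup (fun _ => CuntzDiv.IsDivisible.succ)
      (fun _ _ => CuntzDiv.IsDivisible.succ) fun n => ?_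
    simp only [CuntzDiv.isDivisible_unitClass_iff]
    exact CuntzDiv.solvable_rprod_iff A ω fun _ => ⟨(), s₀, rfl⟩
  · refine CuntzDiv.leastPos_eq_limsup (fun _ => CuntzDiv.IsDecomposable.succ)
      (fun _ _ => CuntzDiv.IsDecomposable.succ) fun n => ?_
    simp only [CuntzDiv.isDecomposable_unitClass_iff]
    exact CuntzDiv.solvable_rprod_iff A ω fun j => ⟨(), j, rfl⟩
  · refine CuntzDiv.leastPos_eq_limsup (fun _ => CuntzDiv.IsWeaklyDivisible.succ)
      (fun _ _ => CuntzDiv.IsWeaklyDivisible.succ) fun n => ?_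
    simp only [CuntzDiv.isWeaklyDivisible_unitClass_iff]
    exact CuntzDiv.solvable_rprod_iff A ω fun j => ⟨j, s₀, rfl⟩
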